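/- **Conventions.** Graphs are finite, simple, undirected, with vertex set $\{1,\dots,n\}$, $n\ge 1$. Fix $r\ge 1$. A function $\alpha$ assigns to every graph $G$ and every two sets $s,t\subseteq V(G)$ with at most $r$ vertices a value $\alpha(s,t)=\alpha_G(s,t)\in\{0,1\}$; $s$ and $t$ *conflict* if $\alpha(s,t)=1$. It is *well-conditioned* if for all $G$ and all such $s,t$, and all $s'\subseteq s$, $t'\subseteq t$: 1. if $\alpha(s,t)=0$, then $\alpha(s',t')=0$; 2. if $\alpha(s,t)=1$, then $|s\cap t|\ge 1$, and moreover $\alpha(s',t')=0$ implies $(s\cap t)\setminus(s'\cap t')\neq\emptyset$; 3. $\alpha_G(s,t)$ is computable from $(G,s,t)$ in time polynomial in $n=|V(G)|$. A property $\Pi$ of induced subgraphs $H$ of a graph $G$ (which may depend on $G$) is *polynomial-time verifiable* if for $|V(H)|\le r$ one can decide from $(G,V(H))$, in time polynomial in $n$, whether $H$ has $\Pi$. *$\Pi$-Packing with $\alpha()$-Overlap*: given a graph $G$ and an integer $k\ge 0$, decide whether $G$ has a set of at least $k$ induced subgraphs, each with at most $r$ vertices and with property $\Pi$, such that $\alpha(V(H),V(H'))=0$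 for any two distinct members $H,H'$. Time is the number of elementary steps of a program with finitely many registers holding binary trees (assign $\mathtt{nil}$, copy, $\mathtt{cons}$, head, tail, test for $\mathtt{nil}$, each at unit cost; sequencing, conditionals, while loops). Graphs are given by adjacency matrices, vertex sets by characteristic vectors, $k$ in unary. **Theorem.** Let $r\ge1$, let $\alpha$ be well-conditioned and let $\Pi$ be polynomial-time verifiable. Then $\Pi$-Packing with $\alpha()$-Overlap can be solved in time $$O\bigl(r^{rk}\,k^{(r+1)k}\,n^{cr}\bigr)$$ (with $0^0=1$) for a constant $c$. More precisely, for every $d$ there is a constant $c$ such that for all $r\ge 1$ and all such $\alpha,\Pi$ that are computable, respectively verifiable, in time $O(n^d)$, some algorithm solves the problem within $C\, r^{rk}k^{(r+1)k}n^{cr}$ steps for all $G$ of order $n\ge1$ and all $k\ge 0$, where $C$ does not depend on $G$ or $k$. -/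

import Mathlib

/-! ### The machine model: WHILE programs over binary trees

Data are finite binary trees built from `nil` and `cons`.  A program works on finitely many
registers, each holding (a pointer to) a tree.  Every elementary instruction, and every test of
a conditional or of a loop, costs one step. -/

/-- Data values: finite binary trees. -/
inductive Val : Type
  | nil : Val
  | cons : Val → Val → Val

namespace Val

/-- First component (`nil` has the first component `nil`). -/
def hd : Val → Val
  | nil => nil
  | cons a _ => a

/-- Second component (`nil` has the second component `nil`). -/
def tl : Val → Val
  | nil => nil
  | cons _ b => b

/-- Truth values: `nil` is false, `cons nil nil` is true. -/
def ofBool : Bool → Val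
  | false => nil
  | true => cons nil nil

/-- Lists, in the usual way. -/
def ofList : List Val → Val
  | [] => nil
  | a :: l => cons a (ofList l)

/-- Natural numbers in unary. -/
def ofNat (k : ℕ) : Val := ofList (List.replicate k nil)

end Val

/-- Programs; the arguments of type `ℕ` are names of registers. -/
inductive Prog : Type
  /-- `x := nil` -/
  | setNil (x : ℕ) : Prog
  /-- `x := y` -/
  | copy (x y : ℕ) : Prog
  /-- `x := cons y z` -/
  | cons (x y z : ℕ) : Prog
  /-- `x := hd y` -/
  | hd (x y : ℕ) : Prog
  /-- `x := tl y` -/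
  | tl (x y : ℕ) : Prog
  /-- `p; q` -/
  | seq (p q : Prog) : Prog
  /-- `if x ≠ nil then p else q` -/
  | ite (x : ℕ) (p q : Prog) : Prog
  /-- `while x ≠ nil do p` -/
  | loop (x : ℕ) (p : Prog) : Prog

/-- Contents of the registers. -/
abbrev Store := ℕ → Val

/-- `Exec p σ t τ`: started in the store `σ`, the program `p` halts after exactly `t` steps, in
the store `τ`. -/
inductive Exec : Prog → Store → ℕ → Store → Prop
  | setNil (x : ℕ) (σ : Store) :
      Exec (.setNil x) σ 1 (Function.update σ x Val.nil)
  | copy (x y : ℕ) (σ : Store) :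
      Exec (.copy x y) σ 1 (Function.update σ x (σ y))
  | cons (x y z : ℕ) (σ : Store) :
      Exec (.cons x y z) σ 1 (Function.update σ x (Val.cons (σ y) (σ z)))
  | hd (x y : ℕ) (σ : Store) :
      Exec (.hd x y) σ 1 (Function.update σ x (σ y).hd)
  | tl (x y : ℕ) (σ : Store) :
      Exec (.tl x y) σ 1 (Function.update σ x (σ y).tl)
  | seq {p q : Prog} {σ τ ρ : Store} {s t : ℕ} :
      Exec p σ s τ → Exec q τ t ρ → Exec (.seq p q) σ (s + t) ρ
  | iteTrue {x : ℕ} {p q : Prog} {σ τ : Store} {t : ℕ} :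
      σ x ≠ Val.nil → Exec p σ t τ → Exec (.ite x p q) σ (t + 1) τ
  | iteFalse {x : ℕ} {p q : Prog} {σ τ : Store} {t : ℕ} :
      σ x = Val.nil → Exec q σ t τ → Exec (.ite x p q) σ (t + 1) τ
  | loopStop {x : ℕ} {p : Prog} {σ : Store} :
      σ x = Val.nil → Exec (.loop x p) σ 1 σ
  | loopStep {x : ℕ} {p : Prog} {σ τ ρ : Store} {s t : ℕ} :
      σ x ≠ Val.nil → Exec p σ s τ → Exec (.loop x p) τ t ρ →
        Exec (.loop x p) σ (s + t + 1) ρ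

/-- The initial store: the input is in register `0`, all other registers hold `nil`. -/
def initStore (input : Val) : Store := Function.update (fun _ => Val.nil) 0 input

/-- On the given input, `p` halts within `T` steps and register `0` then holds the truth value of
the proposition `A`. -/
def DecidesWithin (p : Prog) (input : Val) (A : Prop) (T : ℕ) : Prop :=
  ∃ (t : ℕ) (τ : Store), t ≤ T ∧ Exec p (initStore input) t τ ∧
    ((A ∧ τ 0 = Val.ofBool true) ∨ (¬ A ∧ τ 0 = Val.ofBool false))

/-! ### Encodings -/

open Classical in
/-- A set of vertices, as its characteristic vector of length `n`. -/
noncomputable def encSet {n : ℕ} (s : Set (Fin n)) : Val :=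
  Val.ofList (List.ofFn fun i : Fin n => Val.ofBool (decide (i ∈ s)))

/-- A graph, as its adjacency matrix, the list of its rows. -/
noncomputable def encGraph {n : ℕ} (G : SimpleGraph (Fin n)) : Val :=
  Val.ofList (List.ofFn fun i : Fin n => encSet (G.neighborSet i))

/-! ### Overlap functions, properties, and the packing problem -/

/-- An overlap function assigns to a graph `G` on `n` vertices and to two sets of vertices of `G`
a value in `{0, 1}`; the value `1` (`true`) means that the two sets conflict.  Only its values
on sets of size at most `r` are ever used. -/
abbrev OverlapFn := (n : ℕ) → SimpleGraph (Fin n) → Set (Fin n) → Set (Fin n) → Bool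

/-- A property of subgraphs of a host graph.  It may depend on the host graph, too. -/
abbrev SubgraphProp := (n : ℕ) → (G : SimpleGraph (Fin n)) → G.Subgraph → Prop

/-- `α` is well-conditioned for sets of size at most `r`, where the polynomial time bound of the
third condition is `O(n ^ d)`. -/
structure WellConditioned (r d : ℕ) (α : OverlapFn) : Prop where
  hereditary : ∀ (n : ℕ) (G : SimpleGraph (Fin n)) (s t s' t' : Set (Fin n)),
    s.ncard ≤ r → t.ncard ≤ r → α n G s t = false → s' ⊆ s → t' ⊆ t → α n G s' t' = false
  overlap : ∀ (n : ℕ) (G : SimpleGraph (Fin n)) (s t : Set (Fin n)),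
    s.ncard ≤ r → t.ncard ≤ r → α n G s t = true →
      1 ≤ (s ∩ t).ncard ∧
      ∀ s' t' : Set (Fin n), s' ⊆ s → t' ⊆ t → α n G s' t' = false →
        ((s ∩ t) \ (s' ∩ t')).Nonempty
  computable : ∃ (p : Prog) (C : ℕ), ∀ (n : ℕ) (G : SimpleGraph (Fin n)) (s t : Set (Fin n)),
    0 < n → s.ncard ≤ r → t.ncard ≤ r →
      DecidesWithin p (Val.cons (encGraph G) (Val.cons (encSet s) (encSet t)))
        (α n G s t = true) (C * n ^ d)

/-- Whether a given induced subgraph with at most `r` vertices has the property `P` can be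
verified in time `O(n ^ d)`. -/
def Verifiable (r d : ℕ) (P : SubgraphProp) : Prop :=
  ∃ (p : Prog) (C : ℕ), ∀ (n : ℕ) (G : SimpleGraph (Fin n)) (H : G.Subgraph),
    0 < n → H.IsInduced → H.verts.ncard ≤ r →
      DecidesWithin p (Val.cons (encGraph G) (encSet H.verts)) (P n G H) (C * n ^ d)

/-- `G` contains a packing of at least `k` induced subgraphs, each with at most `r` vertices and
with the property `P`, no two distinct ones of which conflict. -/
def HasPacking (r : ℕ) (P : SubgraphProp) (α : OverlapFn) {n : ℕ} (G : SimpleGraph (Fin n))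
    (k : ℕ) : Prop :=
  ∃ K : Finset G.Subgraph, k ≤ K.card ∧
    (∀ H ∈ K, H.IsInduced ∧ H.verts.ncard ≤ r ∧ P n G H) ∧
    ∀ H ∈ K, ∀ H' ∈ K, H ≠ H' → α n G H.verts H'.verts = false

/-- The packing problem, with input a (non-empty) graph `G` of order `n` and an integer `k`, is
solved by one program in time `O(T n k)`. -/
def PackingSolvableInTime (r : ℕ) (P : SubgraphProp) (α : OverlapFn) (T : ℕ → ℕ → ℕ) : Prop :=
  ∃ (p : Prog) (C : ℕ), ∀ (n : ℕ) (G : SimpleGraph (Fin n)) (k : ℕ), 0 < n →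
    DecidesWithin p (Val.cons (encGraph G) (Val.ofNat k)) (HasPacking r P α G k) (C * T n k)

/-! The algorithm is a bounded search tree. For fixed `r` all sets of at most `r` vertices can be
listed, as `(n + 1) ^ r` unions of singletons with repetitions; those that induce a subgraph with
the property are the candidates, and `k` distinct candidates without conflict are sought. A node
guesses a part of each of the `k` sets, with a budget for the vertices still missing. Its partial
sets are completed greedily, each by any candidate that clashes neither with the completions chosen
before nor with the partial sets still to come. If all of them get a completion, a packing is found.

Suppose that this fails at `p`, although the node extends to a packing, in which `s` completes `p`.
By heredity `s` does not clash with the partial sets to come, so it clashes with an earlier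
completion `d`. But `d` did not clash with `p` when it was chosen, so the second condition on the
overlap function yields a vertex of `s ∩ d` outside `p`. Hence it suffices to branch on the vertices
of the earlier completions, at most `r * (k - 1)` of them, and to restart the greedy completion; the
completions themselves need not belong to any packing (`Setting.alive_expand`). Since a set need not
conflict with itself, distinctness has to be enforced separately: a clash includes equality with a
set of budget `0`, and one more child declares `p` complete.

Every branching has at most `r * k` children and lowers the total budget, initially `r * k`. So
there are `O((r * k) ^ (r * k))` nodes with at most `k + 1` steps each, which a potential function
makes precise (`Setting.total_expand`). Polynomial factors in `k` are absorbed by `k ^ k`.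

Elementary steps are counted through `Run`, which is closed under pairing, conditionals, loops and
folds; the programs given for conflicts and for the property enter by `Run.ofProg`. -/

/-! ### Relocation of programs -/

/-- The program `p` with all registers shifted by `m`. -/
def Prog.shift (m : ℕ) : Prog → Prog
  | .setNil x => .setNil (m + x)
  | .copy x y => .copy (m + x) (m + y)
  | .cons x y z => .cons (m + x) (m + y) (m + z)
  | .hd x y => .hd (m + x) (m + y)
  | .tl x y => .tl (m + x) (m + y)
  | .seq p q => .seq (p.shift m) (q.shift m)
  | .ite x p q => .ite (m + x) (p.shift m) (q.shift m)
  | .loop x p => .loop (m + x) (p.shift m)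

/-- All registers of the program are below this number. -/
def Prog.bound : Prog → ℕ
  | .setNil x => x + 1
  | .copy x y => x + y + 1
  | .cons x y z => x + y + z + 1
  | .hd x y => x + y + 1
  | .tl x y => x + y + 1
  | .seq p q => p.bound + q.bound
  | .ite x p q => x + 1 + p.bound + q.bound
  | .loop x p => x + 1 + p.bound

theorem update_shift {N m x : ℕ} {σ σ' : Store} {u v : Val} (h : ∀ i < N, σ' (m + i) = σ i)
    (huv : u = v) :
    (∀ i < N, Function.update σ' (m + x) u (m + i) = Function.update σ x v i) ∧
      ∀ i < m, Function.update σ' (m + x) u i = σ' i := by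
  refine ⟨fun i hi => ?_, fun i hi => Function.update_of_ne (by omega) _ _⟩
  by_cases hx : i = x
  · subst hx; simp [huv]
  · rw [Function.update_of_ne (by omega), Function.update_of_ne hx, h i hi]

/-- A shifted program simulates the original one. -/
theorem Exec.shift {p : Prog} {σ τ : Store} {t : ℕ} (h : Exec p σ t τ) (m N : ℕ) :
    p.bound ≤ N → ∀ σ' : Store, (∀ i < N, σ' (m + i) = σ i) →
      ∃ τ', Exec (p.shift m) σ' t τ' ∧ (∀ i < N, τ' (m + i) = τ i) ∧ ∀ i < m, τ' i = σ' i := by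
  induction h with
  | setNil x σ =>
    intro _ σ' hσ
    exact ⟨_, .setNil _ _, update_shift hσ rfl⟩
  | copy x y σ =>
    intro hN σ' hσ
    simp only [Prog.bound] at hN
    exact ⟨_, .copy _ _ _, update_shift hσ (hσ y (by omega))⟩
  | cons x y z σ =>
    intro hN σ' hσ
    simp only [Prog.bound] at hN
    exact ⟨_, .cons _ _ _ _, update_shift hσ (by rw [hσ y (by omega), hσ z (by omega)])⟩
  | hd x y σ =>
    intro hN σ' hσ
    simp only [Prog.bound] at hN
    exact ⟨_, .hd _ _ _, update_shift hσ (by rw [hσ y (by omega)])⟩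
  | tl x y σ =>
    intro hN σ' hσ
    simp only [Prog.bound] at hN
    exact ⟨_, .tl _ _ _, update_shift hσ (by rw [hσ y (by omega)])⟩
  | seq _ _ ih₁ ih₂ =>
    intro hN σ' hσ
    simp only [Prog.bound] at hN
    obtain ⟨τ₁, e₁, a₁, b₁⟩ := ih₁ (by omega) σ' hσ
    obtain ⟨τ₂, e₂, a₂, b₂⟩ := ih₂ (by omega) τ₁ a₁
    exact ⟨τ₂, .seq e₁ e₂, a₂, fun i hi => (b₂ i hi).trans (b₁ i hi)⟩
  | iteTrue hx _ ih =>
    intro hN σ' hσ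
    simp only [Prog.bound] at hN
    obtain ⟨τ₁, e₁, a₁, b₁⟩ := ih (by omega) σ' hσ
    exact ⟨τ₁, .iteTrue (by rwa [hσ _ (by omega)]) e₁, a₁, b₁⟩
  | iteFalse hx _ ih =>
    intro hN σ' hσ
    simp only [Prog.bound] at hN
    obtain ⟨τ₁, e₁, a₁, b₁⟩ := ih (by omega) σ' hσ
    exact ⟨τ₁, .iteFalse (by rwa [hσ _ (by omega)]) e₁, a₁, b₁⟩
  | loopStop hx =>
    intro hN σ' hσ
    simp only [Prog.bound] at hN
    exact ⟨σ', .loopStop (by rwa [hσ _ (by omega)]), hσ, fun _ _ => rfl⟩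
  | loopStep hx _ _ ih₁ ih₂ =>
    intro hN σ' hσ
    have hN' := hN
    simp only [Prog.bound] at hN
    obtain ⟨τ₁, e₁, a₁, b₁⟩ := ih₁ (by omega) σ' hσ
    obtain ⟨τ₂, e₂, a₂, b₂⟩ := ih₂ hN' τ₁ a₁
    exact ⟨τ₂, .loopStep (by rwa [hσ _ (by omega)]) e₁ e₂, a₂,
      fun i hi => (b₂ i hi).trans (b₁ i hi)⟩

/-- Clears the registers `m + 1, …, m + N`. -/
def clearAbove (m : ℕ) : ℕ → Prog
  | 0 => .copy m m
  | N + 1 => .seq (clearAbove m N) (.setNil (m + (N + 1)))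

theorem exec_clearAbove (m N : ℕ) (σ : Store) :
    ∃ τ, Exec (clearAbove m N) σ (N + 1) τ ∧ (∀ i, 0 < i → i ≤ N → τ (m + i) = Val.nil) ∧
      ∀ i ≤ m, τ i = σ i := by
  induction N with
  | zero =>
    refine ⟨_, .copy _ _ _, fun i h h' => by omega, fun i _ => ?_⟩
    by_cases h : i = m
    · subst h; simp
    · simp [h]
  | succ N ih =>
    obtain ⟨τ, e, h, h'⟩ := ih
    refine ⟨_, .seq e (.setNil _ _), fun i hi hN => ?_, fun i hi => ?_⟩
    · by_cases hx : i = N + 1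
      · subst hx; simp
      · rw [Function.update_of_ne (by omega), h i hi (by omega)]
    · rw [Function.update_of_ne (by omega), h' i hi]

/-! ### Relocatable code -/

/-- Relocatable code: `F m` has its input and its output in register `m`, uses registers above `m`
as work space, and does not touch the registers below `m`. -/
abbrev Code := ℕ → Prog

/-- On the input `v`, the code `F` computes `w` within `T` steps, at every location. -/
def Run (F : Code) (v w : Val) (T : ℕ) : Prop :=
  ∀ (m : ℕ) (σ : Store), σ m = v →
    ∃ s τ, s ≤ T ∧ Exec (F m) σ s τ ∧ τ m = w ∧ ∀ i < m, τ i = σ i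

namespace Code

/-- Does nothing. -/
def id : Code := fun m => .copy m m
/-- Returns `nil`. -/
def nil : Code := fun m => .setNil m
/-- `F`, followed by taking the first component. -/
def hd (F : Code) : Code := fun m => .seq (F m) (.hd m m)
/-- `F`, followed by taking the second component. -/
def tl (F : Code) : Code := fun m => .seq (F m) (.tl m m)
/-- `F`, followed by `G`. -/
def comp (F G : Code) : Code := fun m => .seq (F m) (G m)
/-- The pair of the results of `F` and `G`. -/
def pair (F G : Code) : Code := fun m =>
  .seq (.seq (.copy (m + 1) m) (F (m + 1)))
    (.seq (.seq (.copy (m + 2) m) (G (m + 2))) (.cons m (m + 1) (m + 2)))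
/-- Case distinction according to the result of `C`. -/
def ite (C F G : Code) : Code := fun m =>
  .seq (.seq (.copy (m + 1) m) (C (m + 1))) (.ite (m + 1) (F m) (G m))
/-- Repeats `F` as long as `C` returns a value other than `nil`. -/
def loop (C F : Code) : Code := fun m =>
  .seq (.seq (.copy (m + 1) m) (C (m + 1)))
    (.loop (m + 1) (.seq (F m) (.seq (.copy (m + 1) m) (C (m + 1)))))
/-- Runs the program `p` on the input. -/
def ofProg (p : Prog) : Code := fun m => .seq (clearAbove m p.bound) (p.shift m)
/-- Returns the constant `v`. -/
def const : Val → Code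
  | .nil => nil
  | .cons a b => pair (const a) (const b)

end Code

/-! ### Cost of the control structures -/

namespace Run

variable {F G C : Code} {u u' v w : Val} {S T U : ℕ}

theorem mono (h : Run F v w S) (hT : S ≤ T) : Run F v w T := fun m σ hσ =>
  let ⟨s, τ, hs, e, a, b⟩ := h m σ hσ
  ⟨s, τ, hs.trans hT, e, a, b⟩

theorem id (v : Val) : Run Code.id v v 1 := fun m σ hσ =>
  ⟨1, _, le_rfl, .copy _ _ _, by simp [hσ], fun i hi => by simp [hi.ne]⟩

theorem nil (v : Val) : Run Code.nil v Val.nil 1 := fun m σ _ =>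
  ⟨1, _, le_rfl, .setNil _ _, by simp, fun i hi => by simp [hi.ne]⟩

theorem hd (h : Run F v w T) : Run F.hd v w.hd (T + 1) := fun m σ hσ =>
  let ⟨s, τ, hs, e, a, b⟩ := h m σ hσ
  ⟨s + 1, _, by omega, .seq e (.hd _ _ _), by simp [a], fun i hi => by simp [hi.ne, b i hi]⟩

theorem tl (h : Run F v w T) : Run F.tl v w.tl (T + 1) := fun m σ hσ =>
  let ⟨s, τ, hs, e, a, b⟩ := h m σ hσ
  ⟨s + 1, _, by omega, .seq e (.tl _ _ _), by simp [a], fun i hi => by simp [hi.ne, b i hi]⟩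

theorem comp (h : Run F u v S) (h' : Run G v w T) : Run (F.comp G) u w (S + T) := fun m σ hσ =>
  let ⟨s, τ, hs, e, a, b⟩ := h m σ hσ
  let ⟨s', τ', hs', e', a', b'⟩ := h' m τ a
  ⟨s + s', τ', by omega, .seq e e', a', fun i hi => (b' i hi).trans (b i hi)⟩

/-- Running the code on a copy of the input. -/
theorem exec_copy (h : Run F v w T) {m j : ℕ} {σ : Store} (hσ : σ m = v) :
    ∃ s τ, s ≤ T + 1 ∧ Exec (.seq (.copy j m) (F j)) σ s τ ∧ τ j = w ∧ ∀ i < j, τ i = σ i := by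
  obtain ⟨s, τ, hs, e, a, b⟩ := h j (Function.update σ j (σ m)) (by simp [hσ])
  exact ⟨1 + s, τ, by omega, .seq (.copy _ _ _) e, a, fun i hi => by
    rw [b i hi, Function.update_of_ne (by omega)]⟩

/-- The second computation works from register `m + 2` upwards, so it preserves both the input in
`m` and the first result in `m + 1`. -/
theorem pair (h : Run F u v S) (h' : Run G u w T) :
    Run (F.pair G) u (v.cons w) (S + T + 3) := fun m σ hσ => by
  obtain ⟨s, τ, hs, e, a, b⟩ := h.exec_copy (j := m + 1) hσ
  obtain ⟨s', τ', hs', e', a', b'⟩ := h'.exec_copy (j := m + 2) ((b m (by omega)).trans hσ)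
  refine ⟨s + (s' + 1), _, by omega, .seq e (.seq e' (.cons _ _ _ _)), ?_, fun i hi => ?_⟩
  · simp [a', b' (m + 1) (by omega), a]
  · rw [Function.update_of_ne (by omega), b' i (by omega), b i (by omega)]

theorem ite (hC : Run C u w S) (hF : w ≠ Val.nil → Run F u v T) (hG : w = Val.nil → Run G u v T) :
    Run (Code.ite C F G) u v (S + T + 2) := fun m σ hσ => by
  obtain ⟨s, τ, hs, e, a, b⟩ := hC.exec_copy (j := m + 1) hσ
  by_cases hw : w = Val.nil
  · obtain ⟨s', τ', hs', e', a', b'⟩ := hG hw m τ ((b m (by omega)).trans hσ)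
    exact ⟨s + (s' + 1), τ', by omega, .seq e (.iteFalse (a.trans hw) e'), a', fun i hi =>
      (b' i hi).trans (b i (by omega))⟩
  · obtain ⟨s', τ', hs', e', a', b'⟩ := hF hw m τ ((b m (by omega)).trans hσ)
    exact ⟨s + (s' + 1), τ', by omega, .seq e (.iteTrue (by rwa [a]) e'), a', fun i hi =>
      (b' i hi).trans (b i (by omega))⟩

theorem _root_.Val.ofBool_ne_nil {b : Bool} : Val.ofBool b ≠ Val.nil ↔ b = true := by
  cases b <;> simp [Val.ofBool]

theorem _root_.Val.ofBool_eq_nil {b : Bool} : Val.ofBool b = Val.nil ↔ b = false := by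
  cases b <;> simp [Val.ofBool]

theorem cond {b : Bool} (hC : Run C u (Val.ofBool b) S) (hF : b = true → Run F u v T)
    (hG : b = false → Run G u v T) : Run (Code.ite C F G) u v (S + T + 2) :=
  hC.ite (fun h => hF (Val.ofBool_ne_nil.1 h)) (fun h => hG (Val.ofBool_eq_nil.1 h))

theorem loop_stop (hC : Run C u Val.nil S) : Run (Code.loop C F) u u (S + 2) := fun m σ hσ => by
  obtain ⟨s, τ, hs, e, a, b⟩ := hC.exec_copy (j := m + 1) hσ
  exact ⟨s + 1, τ, by omega, .seq e (.loopStop a), (b m (by omega)).trans hσ, fun i hi =>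
    b i (by omega)⟩

theorem loop_step (hC : Run C u v S) (hv : v ≠ Val.nil) (hF : Run F u u' T)
    (hL : Run (Code.loop C F) u' w U) : Run (Code.loop C F) u w (S + T + U + 2) := fun m σ hσ => by
  obtain ⟨s, τ, hs, e, a, b⟩ := hC.exec_copy (j := m + 1) hσ
  obtain ⟨s', τ', hs', e', a', b'⟩ := hF m τ ((b m (by omega)).trans hσ)
  obtain ⟨s'', τ'', hs'', e'', a'', b''⟩ := hL m τ' a'
  -- The run from `u'` begins with an evaluation of the test; that evaluation serves as the end of
  -- the first pass through the body.
  cases e'' with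
  | seq e₁ e₂ =>
    exact ⟨_, τ'', by omega, .seq e (.loopStep (by rwa [a]) (.seq e' e₁) e₂), a'', fun i hi =>
      (b'' i hi).trans ((b' i hi).trans (b i (by omega)))⟩

/-- A loop whose state `x` is controlled by an invariant and a decreasing measure. -/
theorem loop {X : Type*} (enc : X → Val) (cond : X → Val) (next : X → X) (inv : X → Prop)
    (μ : X → ℕ) (hC : ∀ x, inv x → Run C (enc x) (cond x) S)
    (hF : ∀ x, inv x → cond x ≠ Val.nil →
      Run F (enc x) (enc (next x)) T ∧ inv (next x) ∧ μ (next x) < μ x) (x : X) (hx : inv x) :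
    ∃ y, inv y ∧ cond y = Val.nil ∧
      Run (Code.loop C F) (enc x) (enc y) ((μ x + 1) * (S + T + 2)) := by
  induction hn : μ x using Nat.strong_induction_on generalizing x with
  | _ n ih =>
    by_cases hc : cond x = Val.nil
    · exact ⟨x, hx, hc, (loop_stop (hc ▸ hC x hx)).mono (by nlinarith)⟩
    · obtain ⟨h₁, h₂, h₃⟩ := hF x hx hc
      obtain ⟨y, hy, hy', h⟩ := ih _ (hn ▸ h₃) _ h₂ rfl
      refine ⟨y, hy, hy', (loop_step (hC x hx) hc h₁ h).mono ?_⟩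
      have : μ (next x) + 1 ≤ n := hn ▸ h₃
      nlinarith [Nat.mul_le_mul_right (S + T + 2) this]

/-- The work space may hold leftovers, whereas `p` expects `nil` outside register `0`. Clearing as
many registers as `p` can mention makes the store agree with `initStore` wherever `p` can notice. -/
theorem ofProg {p : Prog} {t : ℕ} {τ : Store} (h : Exec p (initStore v) t τ) :
    Run (Code.ofProg p) v (τ 0) (p.bound + 1 + t) := fun m σ hσ => by
  obtain ⟨ρ, e, a, b⟩ := exec_clearAbove m p.bound σ
  -- One more than the bound, so that the output register `0` is certainly among those compared.
  have hN : p.bound ≤ p.bound + 1 := by omega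
  obtain ⟨τ', e', a', b'⟩ := h.shift m (p.bound + 1) hN ρ fun i hi => by
    rcases Nat.eq_zero_or_pos i with rfl | hi'
    · simp [b m le_rfl, hσ, initStore]
    · rw [a i hi' (by omega), initStore, Function.update_of_ne hi'.ne']
  exact ⟨_, τ', le_rfl, .seq e e', by simpa using a' 0 (by omega), fun i hi =>
    (b' i hi).trans (b i hi.le)⟩

theorem const (c : Val) : ∃ T, ∀ v, Run (Code.const c) v c T := by
  induction c with
  | nil => exact ⟨_, nil⟩
  | cons a b iha ihb =>
    obtain ⟨S, hS⟩ := iha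
    obtain ⟨T, hT⟩ := ihb
    exact ⟨_, fun v => (hS v).pair (hT v)⟩

end Run

theorem DecidesWithin.run {p : Prog} {v : Val} {A : Prop} [Decidable A] {T : ℕ}
    (h : DecidesWithin p v A T) :
    Run (Code.ofProg p) v (Val.ofBool (decide A)) (p.bound + 1 + T) := by
  obtain ⟨t, τ, ht, e, h⟩ := h
  have hr : Val.ofBool (decide A) = τ 0 := by
    rcases h with ⟨h, h'⟩ | ⟨h, h'⟩ <;> simp [h, h']
  rw [hr]
  exact (Run.ofProg e).mono (by omega)

theorem Run.decidesWithin {F : Code} {v : Val} {A : Prop} {b : Bool} {T : ℕ}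
    (h : Run F v (Val.ofBool b) T) (hA : b = true ↔ A) : DecidesWithin (F 0) v A T := by
  obtain ⟨s, τ, hs, e, a, _⟩ := h 0 (initStore v) (by simp [initStore])
  refine ⟨s, τ, hs, e, ?_⟩
  cases b
  · exact .inr ⟨fun hh => by simpa using hA.2 hh, a⟩
  · exact .inl ⟨hA.1 rfl, a⟩

/-! ### Programming with lists -/

/-- Encoding of a list, given an encoding of its members. -/
def encList {A : Type*} (enc : A → Val) (l : List A) : Val := Val.ofList (l.map enc)

/-- Left fold: on the input `(e, (a, l))`, with `F` mapping `(e, (a, y))` to the next value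
of the accumulator. -/
def Code.fold (F : Code) : Code :=
  ((Code.id.tl.tl).loop
    (Code.id.hd.pair
      (((Code.id.hd.pair (Code.id.tl.hd.pair Code.id.tl.tl.hd)).comp F).pair
        Code.id.tl.tl.tl))).tl.hd

namespace Run

variable {F G C : Code} {S T : ℕ}

/-- A fold with an invariant that may depend on the remaining part of the list. -/
theorem fold_of_inv {A Y : Type*} {encA : A → Val} {encY : Y → Val} {e : Val} {f : A → Y → A}
    (inv : List Y → A → Prop) (l : List Y)
    (hF : ∀ a y l', inv (y :: l') a → y ∈ l →
      inv l' (f a y) ∧ Run F (e.cons ((encA a).cons (encY y))) (encA (f a y)) T) (a : A)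
    (ha : inv l a) :
    Run F.fold (e.cons ((encA a).cons (encList encY l))) (encA (l.foldl f a))
      (l.length * (T + 40) + 40) := by
  suffices h : ∀ l' ⊆ l, ∀ a, inv l' a → ∃ v,
      Run ((Code.id.tl.tl).loop (Code.id.hd.pair
        (((Code.id.hd.pair (Code.id.tl.hd.pair Code.id.tl.tl.hd)).comp F).pair
        Code.id.tl.tl.tl))) (e.cons ((encA a).cons (encList encY l')))
        (e.cons ((encA (l'.foldl f a)).cons v)) (l'.length * (T + 40) + 10) by
    obtain ⟨v, h⟩ := h l (List.Subset.refl l) a ha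
    exact h.tl.hd.mono (by omega)
  intro l'
  induction l' with
  | nil =>
    intro _ a _
    exact ⟨_, (loop_stop (Run.id _).tl.tl).mono (by simp)⟩
  | cons y l' ih =>
    intro hl a ha
    obtain ⟨hi, hr⟩ := hF a y l' ha (hl (by simp))
    obtain ⟨v, h⟩ := ih (fun z hz => hl (List.mem_cons_of_mem _ hz)) _ hi
    refine ⟨v, (loop_step (v := encList encY (y :: l')) (Run.id _).tl.tl
      (by simp [encList, Val.ofList])
      ((Run.id _).hd.pair ((((Run.id _).hd.pair
        ((Run.id _).tl.hd.pair (Run.id _).tl.tl.hd)).comp hr).pair (Run.id _).tl.tl.tl)) h).mono ?_⟩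
    simp only [List.length_cons, Nat.succ_mul]
    omega

theorem fold {A Y : Type*} {encA : A → Val} {encY : Y → Val} {e : Val} {f : A → Y → A}
    (l : List Y)
    (hF : ∀ a, ∀ y ∈ l, Run F (e.cons ((encA a).cons (encY y))) (encA (f a y)) T) (a : A) :
    Run F.fold (e.cons ((encA a).cons (encList encY l))) (encA (l.foldl f a))
      (l.length * (T + 40) + 40) :=
  fold_of_inv (fun _ _ => True) l (fun a y _ _ hy => ⟨trivial, hF a y hy⟩) a trivial

/-- `push C G` maps `(e, (a, l))` to the list `a`, to which the values `G (e, y)` were pushed for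
the `y ∈ l` with `C (e, y)`. -/
def _root_.Code.push (C G : Code) : Code :=
  Code.fold (Code.ite ((Code.id.hd.pair Code.id.tl.tl).comp C)
    (((Code.id.hd.pair Code.id.tl.tl).comp G).pair Code.id.tl.hd) Code.id.tl.hd)

theorem push {A Y : Type*} {encA : A → Val} {encY : Y → Val} {e : Val} {c : Y → Bool} {g : Y → A}
    (l : List Y) (hC : ∀ y ∈ l, Run C (e.cons (encY y)) (Val.ofBool (c y)) S)
    (hG : ∀ y ∈ l, c y = true → Run G (e.cons (encY y)) (encA (g y)) T) (a : List A) :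
    Run (Code.push C G) (e.cons ((encList encA a).cons (encList encY l)))
      (encList encA (((l.filter c).map g).reverse ++ a)) (l.length * (S + T + 80) + 40) := by
  have key : ∀ (l : List Y) (a : List A),
      l.foldl (fun a y => if c y then g y :: a else a) a = ((l.filter c).map g).reverse ++ a := by
    intro l
    induction l with
    | nil => simp
    | cons y l ih =>
      intro a
      rw [List.foldl_cons, ih]
      by_cases h : c y = true <;> simp [h]
  rw [← key]
  refine (fold (encA := encList encA) (encY := encY) (T := S + T + 40) l
    (fun a y hy => ?_) a).mono (by nlinarith)
  refine (cond (T := T + 20) (((Run.id _).hd.pair (Run.id _).tl.tl).comp (hC y hy)) (fun h => ?_)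
    (fun h => ?_)).mono (by omega)
  · rw [if_pos h]
    exact ((((Run.id _).hd.pair (Run.id _).tl.tl).comp (hG y hy h)).pair (Run.id _).tl.hd).mono
      (by omega)
  · rw [if_neg (by simp [h])]
    exact (Run.id _).tl.hd.mono (by omega)

/-- Truth value `true`. -/
def _root_.Code.true : Code := Code.nil.pair Code.nil

theorem true (v : Val) : Run Code.true v (Val.ofBool Bool.true) 5 := (nil v).pair (nil v)

/-- Pushing the values for all members of a list. -/
theorem map {A Y : Type*} {encA : A → Val} {encY : Y → Val} {e : Val} {g : Y → A}
    (l : List Y) (hG : ∀ y ∈ l, Run G (e.cons (encY y)) (encA (g y)) T) (a : List A) :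
    Run (Code.push Code.true G) (e.cons ((encList encA a).cons (encList encY l)))
      (encList encA ((l.map g).reverse ++ a)) (l.length * (T + 85) + 40) := by
  have := push (encA := encA) (c := fun _ => Bool.true) l (fun y _ => Run.true _)
    (fun y hy _ => hG y hy) a
  rw [List.filter_true] at this
  exact this.mono (by nlinarith)

/-- `any C` decides for the input `(e, l)` whether `C (e, y)` for some `y ∈ l`. -/
def _root_.Code.any (C : Code) : Code :=
  (Code.id.hd.pair (Code.nil.pair Code.id.tl)).comp
    (Code.fold (Code.ite Code.id.tl.hd Code.true ((Code.id.hd.pair Code.id.tl.tl).comp C)))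

theorem any {Y : Type*} {encY : Y → Val} {e : Val} {c : Y → Bool}
    (l : List Y) (hC : ∀ y ∈ l, Run C (e.cons (encY y)) (Val.ofBool (c y)) S) :
    Run (Code.any C) (e.cons (encList encY l)) (Val.ofBool (l.any c))
      (l.length * (S + 80) + 80) := by
  have key : ∀ (l : List Y) (a : Bool), l.foldl (fun a y => a || c y) a = (a || l.any c) := by
    intro l
    induction l with
    | nil => simp
    | cons y l ih => intro a; rw [List.foldl_cons, ih]; simp [Bool.or_assoc]
  have h := key l false
  rw [Bool.false_or] at h
  rw [← h]
  refine (((Run.id _).hd.pair ((Run.nil _).pair (Run.id _).tl)).comp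
    (fold (encA := Val.ofBool) (encY := encY) (T := S + 20) l
      (fun a y hy => ?_) false)).mono (by nlinarith)
  refine (cond (T := S + 10) (Run.id _).tl.hd (fun h => ?_) (fun h => ?_)).mono (by omega)
  · rw [show a = Bool.true from h, Bool.true_or]
    exact (Run.true _).mono (by omega)
  · rw [show a = false from h, Bool.false_or]
    exact (((Run.id _).hd.pair (Run.id _).tl.tl).comp (hC y hy)).mono (by omega)

theorem or {b c : Bool} {v : Val} (h : Run F v (Val.ofBool b) S) (h' : Run G v (Val.ofBool c) T) :
    Run (F.ite Code.true G) v (Val.ofBool (b || c)) (S + T + 7) := by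
  refine (cond (T := T + 5) h (fun hb => ?_) fun hb => ?_).mono (by omega)
  · rw [hb]; exact (Run.true _).mono (by omega)
  · rw [hb]; exact h'.mono (by omega)

theorem and {b c : Bool} {v : Val} (h : Run F v (Val.ofBool b) S) (h' : Run G v (Val.ofBool c) T) :
    Run (F.ite G Code.nil) v (Val.ofBool (b && c)) (S + T + 7) := by
  refine (cond (T := T + 5) h (fun hb => ?_) fun hb => ?_).mono (by omega)
  · rw [hb]; exact h'.mono (by omega)
  · rw [hb]; exact (Run.nil _).mono (by omega)

theorem not {b : Bool} {v : Val} (h : Run F v (Val.ofBool b) S) :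
    Run (F.ite Code.nil Code.true) v (Val.ofBool (!b)) (S + 7) := by
  refine (cond (T := 5) h (fun hb => ?_) fun hb => ?_).mono (by omega)
  · rw [hb]; exact (Run.nil _).mono (by omega)
  · rw [hb]; exact (Run.true _).mono (by omega)

end Run

/-! ### Characteristic vectors -/

/-- The characteristic vector of a set. -/
def vec {n : ℕ} (s : Finset (Fin n)) : List Bool := List.ofFn fun i => decide (i ∈ s)

/-- The encoding of a finite set of vertices. -/
noncomputable def encF {n : ℕ} (s : Finset (Fin n)) : Val := encSet (s : Set (Fin n))

theorem encF_eq {n : ℕ} (s : Finset (Fin n)) : encF s = encList Val.ofBool (vec s) := by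
  unfold encF encSet encList vec
  rw [List.map_ofFn]
  congr 2
  funext i
  simp

@[simp] theorem length_vec {n : ℕ} (s : Finset (Fin n)) : (vec s).length = n := by simp [vec]

theorem vec_union {n : ℕ} (s t : Finset (Fin n)) :
    vec (s ∪ t) = List.zipWith or (vec s) (vec t) := by
  apply List.ext_getElem
  · simp
  · intro i h₁ h₂
    simp [vec]

theorem subset_iff_vec {n : ℕ} (s t : Finset (Fin n)) :
    decide (s ⊆ t) = (List.zipWith (fun a b => !a || b) (vec s) (vec t)).all id := by
  rw [Bool.eq_iff_iff, decide_eq_true_iff, List.all_eq_true]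
  constructor
  · intro h x hx
    obtain ⟨i, hi, rfl⟩ := List.getElem_of_mem hx
    simp only [List.length_zipWith, length_vec, min_self] at hi
    have := @h ⟨i, hi⟩
    simp only [vec, List.getElem_zipWith, List.getElem_ofFn, id]
    by_cases h' : (⟨i, hi⟩ : Fin n) ∈ s <;> simp [h', this]
  · intro h i hi
    have := h ((List.zipWith (fun a b => !a || b) (vec s) (vec t))[i.1]'(by simp))
      (List.getElem_mem _)
    simpa [vec, hi] using this

/-- Union of two sets. -/
theorem exists_run_union : ∃ F c, ∀ (n : ℕ) (s t : Finset (Fin n)),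
    Run F ((encF s).cons (encF t)) (encF (s ∪ t)) (c * (n + 1)) := by
  -- The second vector travels in the accumulator and loses its head at each step; as the lengths
  -- agree, the default of `headD` is never used.
  have key : ∀ l w : List Bool, l.length = w.length → ∀ a : List Bool,
      (l.foldl (fun (a : List Bool × List Bool) y => ((y || a.2.headD false) :: a.1, a.2.tail))
        (a, w)).1 = (List.zipWith or l w).reverse ++ a := by
    intro l
    induction l with
    | nil => simp
    | cons y l ih =>
      intro w hw a
      cases w with
      | nil => simp at hw
      | cons z w => rw [List.foldl_cons, ih _ (by simpa using hw)]; simp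
  -- The program stays a metavariable, filled by unification with the run assembled below. It was
  -- created before `n`, `s`, `t` were introduced and thus cannot depend on them. Most programs
  -- below are obtained in this way.
  apply Exists.intro
  refine ⟨1000, fun n s t => ?_⟩
  have h₁ := Run.fold (T := 40)
    (F := ((Code.id.tl.tl.ite Code.true Code.id.tl.hd.tl.hd).pair Code.id.tl.hd.hd).pair
      Code.id.tl.hd.tl.tl)
    (encA := fun a : List Bool × List Bool =>
      (encList Val.ofBool a.1).cons (encList Val.ofBool a.2)) (encY := Val.ofBool) (e := Val.nil)
    (f := fun a y => ((y || a.2.headD false) :: a.1, a.2.tail)) (vec s)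
    (fun a y _ => by
      obtain ⟨a, w⟩ := a
      have h : Run Code.id.tl.hd.tl.hd
          (Val.nil.cons (((encList Val.ofBool a).cons (encList Val.ofBool w)).cons (Val.ofBool y)))
          (Val.ofBool (w.headD false)) 5 := by
        have := (Run.id (Val.nil.cons (((encList Val.ofBool a).cons
          (encList Val.ofBool w)).cons (Val.ofBool y)))).tl.hd.tl.hd
        cases w <;> exact this
      have h' : Run Code.id.tl.hd.tl.tl
          (Val.nil.cons (((encList Val.ofBool a).cons (encList Val.ofBool w)).cons (Val.ofBool y)))
          (encList Val.ofBool w.tail) 5 := by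
        have := (Run.id (Val.nil.cons (((encList Val.ofBool a).cons
          (encList Val.ofBool w)).cons (Val.ofBool y)))).tl.hd.tl.tl
        cases w <;> exact this
      exact (((Run.or (Run.id _).tl.tl h).pair (Run.id _).tl.hd.hd).pair h').mono (by norm_num))
    ([], vec t)
  -- The fold delivers the vector reversed; pushing its entries unchanged onto the empty list
  -- restores the order.
  have h₂ := Run.map (G := Code.id.tl) (T := 2) (encA := Val.ofBool) (encY := Val.ofBool)
    (e := Val.nil) (g := id) (List.zipWith or (vec s) (vec t)).reverse
    (fun y _ => (Run.id _).tl) []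
  rw [encF_eq, encF_eq, encF_eq, vec_union]
  have h₁' := (((Run.nil ((encList Val.ofBool (vec s)).cons (encList Val.ofBool (vec t)))).pair
    (((Run.nil _).pair (Run.id _).tl).pair (Run.id _).hd)).comp h₁).hd
  simp only [key (vec s) (vec t) (by simp) []] at h₁'
  simp only [List.map_id, List.reverse_reverse, List.append_nil] at h₂ h₁'
  have h₂' := ((Run.nil _).pair ((Run.nil _).pair h₁')).comp h₂
  have h₃ : (List.zipWith or (vec s) (vec t)).length = n := by simp
  refine h₂'.mono ?_
  simp
  omega

/-- Test for inclusion. -/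
theorem exists_run_subset : ∃ F c, ∀ (n : ℕ) (s t : Finset (Fin n)),
    Run F ((encF s).cons (encF t)) (Val.ofBool (decide (s ⊆ t))) (c * (n + 1)) := by
  have key : ∀ l w : List Bool, l.length = w.length → ∀ a : Bool,
      (l.foldl (fun (a : Bool × List Bool) y => (a.1 && (!y || a.2.headD false), a.2.tail))
        (a, w)).1 = (a && (List.zipWith (fun a b => !a || b) l w).all id) := by
    intro l
    induction l with
    | nil => simp
    | cons y l ih =>
      intro w hw a
      cases w with
      | nil => simp at hw
      | cons z w =>
        rw [List.foldl_cons, ih _ (by simpa using hw)]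
        simp [Bool.and_assoc]
  apply Exists.intro
  refine ⟨1000, fun n s t => ?_⟩
  have h₁ := Run.fold (T := 100)
    (F := (Code.id.tl.hd.hd.ite ((Code.id.tl.tl.ite Code.nil Code.true).ite Code.true
      Code.id.tl.hd.tl.hd) Code.nil).pair Code.id.tl.hd.tl.tl)
    (encA := fun a : Bool × List Bool =>
      (Val.ofBool a.1).cons (encList Val.ofBool a.2)) (encY := Val.ofBool) (e := Val.nil)
    (f := fun a y => (a.1 && (!y || a.2.headD false), a.2.tail)) (vec s)
    (fun a y _ => by
      obtain ⟨a, w⟩ := a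
      have h : Run Code.id.tl.hd.tl.hd
          (Val.nil.cons (((Val.ofBool a).cons (encList Val.ofBool w)).cons (Val.ofBool y)))
          (Val.ofBool (w.headD false)) 5 := by
        have := (Run.id (Val.nil.cons (((Val.ofBool a).cons
          (encList Val.ofBool w)).cons (Val.ofBool y)))).tl.hd.tl.hd
        cases w <;> exact this
      have h' : Run Code.id.tl.hd.tl.tl
          (Val.nil.cons (((Val.ofBool a).cons (encList Val.ofBool w)).cons (Val.ofBool y)))
          (encList Val.ofBool w.tail) 5 := by
        have := (Run.id (Val.nil.cons (((Val.ofBool a).cons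
          (encList Val.ofBool w)).cons (Val.ofBool y)))).tl.hd.tl.tl
        cases w <;> exact this
      exact ((Run.and (Run.id _).tl.hd.hd (Run.or (Run.not (Run.id _).tl.tl) h)).pair h').mono
        (by norm_num))
    (true, vec t)
  rw [encF_eq, encF_eq, subset_iff_vec]
  have h₁' := (((Run.nil ((encList Val.ofBool (vec s)).cons (encList Val.ofBool (vec t)))).pair
    (((Run.true _).pair (Run.id _).tl).pair (Run.id _).hd)).comp h₁).hd
  simp only [key (vec s) (vec t) (by simp) true] at h₁'
  refine h₁'.mono ?_
  simp
  omega

/-! ### The search tree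

A node of the search tree is a list of `k` partial sets `(s, b)`, where `b` is the number of
vertices that may still be added to `s`.  Partial sets are completed greedily; when this is
impossible, the first set that has no completion is enlarged by a vertex of one of the earlier
completions, or declared to be complete. -/

namespace Search

/-- A partial set with its budget. -/
abbrev Part (n : ℕ) := Finset (Fin n) × ℕ

/-- A node together with the state of its greedy completion: the completions found so far, the
corresponding partial sets, and the remaining partial sets. -/
structure State (n : ℕ) where
  done : List (Part n)
  pre : List (Part n)
  rest : List (Part n)

variable {n : ℕ}

/-- The set `Q` conflicts with a partial set, or equals it while it is complete. -/
def bad (conf : Finset (Fin n) → Finset (Fin n) → Bool) (Q : Finset (Fin n)) (p : Part n) : Bool :=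
  conf Q p.1 || (decide (p.2 = 0) && (decide (Q ⊆ p.1) && decide (p.1 ⊆ Q)))

/-- The set `Q` is an admissible completion of `p`. -/
def fits (conf : Finset (Fin n) → Finset (Fin n) → Bool) (done rest : List (Part n)) (p : Part n)
    (Q : Finset (Fin n)) : Bool :=
  (decide (p.1 ⊆ Q) && (!decide (p.2 = 0) || decide (Q ⊆ p.1))) &&
    !(done.any (bad conf Q) || rest.any (bad conf Q))

/-- The node that consists of the given partial sets. -/
def fresh (p : Part n) (base : List (Part n)) : State n := ⟨[], [], p :: base⟩

/-- Pushes the children in which `p` is enlarged by a vertex of a set in `done`. -/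
def branch (singles : List (Finset (Fin n))) (p : Part n) (base : List (Part n))
    (done : List (Part n)) (wl : List (State n)) : List (State n) :=
  done.foldl (fun acc q => ((singles.filter fun w => decide (w ⊆ q.1)).map fun w =>
    fresh (p.1 ∪ w, p.2 - 1) base).reverse ++ acc) wl

/-- Pushes the successors of a state in which `p` is the next partial set. -/
def expand (conf : Finset (Fin n) → Finset (Fin n) → Bool) (cands singles : List (Finset (Fin n)))
    (done pre : List (Part n)) (p : Part n) (rest : List (Part n)) (wl : List (State n)) :
    List (State n) :=
  match (cands.filter (fits conf done rest p)).reverse with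
  | Q :: _ => ⟨(Q, 0) :: done, p :: pre, rest⟩ :: wl
  | [] => if p.2 = 0 then wl else
      branch singles p (pre.reverse ++ rest) done (fresh (p.1, 0) (pre.reverse ++ rest) :: wl)

/-- One step of the search: the truth value tells whether a packing was found. -/
def step (conf : Finset (Fin n) → Finset (Fin n) → Bool) (cands singles : List (Finset (Fin n))) :
    Bool × List (State n) → Bool × List (State n)
  | (a, []) => (a, [])
  | (_, ⟨_, _, []⟩ :: _) => (true, [])
  | (a, ⟨done, pre, p :: rest⟩ :: wl) => (a, expand conf cands singles done pre p rest wl)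

/-- What the search needs to know about conflicts and candidates. -/
structure Setting (r : ℕ) (conf : Finset (Fin n) → Finset (Fin n) → Bool)
    (cands singles : List (Finset (Fin n))) : Prop where
  symm : ∀ s t, conf s t = conf t s
  card_le : ∀ s ∈ cands, s.card ≤ r
  mono : ∀ s t s', s.card ≤ r → t.card ≤ r → conf s t = false → s' ⊆ s → conf s' t = false
  ext : ∀ s t s', s.card ≤ r → t.card ≤ r → conf s t = true → s' ⊆ s → conf s' t = false →
    ∃ v ∈ s, v ∈ t ∧ v ∉ s'
  singles_perm : singles.Perm ((List.finRange n).map fun i => {i})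

/-- Different and free of conflict. -/
def Compat (conf : Finset (Fin n) → Finset (Fin n) → Bool) (s t : Finset (Fin n)) : Prop :=
  conf s t = false ∧ s ≠ t

/-- There are `k` pairwise compatible candidates. -/
def Packs (conf : Finset (Fin n) → Finset (Fin n) → Bool) (cands : List (Finset (Fin n)))
    (k : ℕ) : Prop :=
  ∃ S : List (Finset (Fin n)), S.length = k ∧ S.Pairwise (Compat conf) ∧ ∀ s ∈ S, s ∈ cands

/-- The set `s` is a possible completion of `p`. -/
def Completes (s : Finset (Fin n)) (p : Part n) : Prop := p.1 ⊆ s ∧ s.card ≤ p.1.card + p.2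

/-- The node can be completed to a packing. -/
def Alive (conf : Finset (Fin n) → Finset (Fin n) → Bool) (cands : List (Finset (Fin n)))
    (q : State n) : Prop :=
  ∃ A B, List.Forall₂ Completes A q.pre ∧ List.Forall₂ Completes B q.rest ∧
    (A ++ B).Pairwise (Compat conf) ∧ ∀ s ∈ A ++ B, s ∈ cands

/-- The invariant of the states. -/
structure Good (r k : ℕ) (conf : Finset (Fin n) → Finset (Fin n) → Bool)
    (cands : List (Finset (Fin n))) (q : State n) : Prop where
  length_pre : q.pre.length = q.done.length
  length : q.done.length + q.rest.length = k
  mem_cands : ∀ p ∈ q.done, p.2 = 0 ∧ p.1 ∈ cands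
  pairwise : (q.done.map Prod.fst).Pairwise (Compat conf)
  not_bad : ∀ d ∈ q.done, ∀ p ∈ q.rest, bad conf d.1 p = false
  card_pre : ∀ p ∈ q.pre, p.1.card + p.2 ≤ r
  card_rest : ∀ p ∈ q.rest, p.1.card + p.2 ≤ r

theorem exists_of_forall₂ {A B : Type*} {R : A → B → Prop} {l : List A} {l' : List B}
    (h : List.Forall₂ R l l') {b : B} (hb : b ∈ l') : ∃ a ∈ l, R a b := by
  induction h with
  | nil => simp at hb
  | cons h _ ih =>
    rcases List.mem_cons.1 hb with rfl | hb
    · exact ⟨_, by simp, h⟩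
    · obtain ⟨a, ha, h⟩ := ih hb
      exact ⟨a, List.mem_cons_of_mem _ ha, h⟩

theorem mem_branch {singles : List (Finset (Fin n))} {p : Part n} {base done : List (Part n)}
    {wl : List (State n)} {x : State n} :
    x ∈ branch singles p base done wl ↔
      x ∈ wl ∨ ∃ q ∈ done, ∃ w ∈ singles, w ⊆ q.1 ∧ x = fresh (p.1 ∪ w, p.2 - 1) base := by
  unfold branch
  induction done generalizing wl with
  | nil => simp
  | cons q done ih =>
    rw [List.foldl_cons, ih]
    simp only [List.mem_append, List.mem_reverse, List.mem_map, List.mem_filter,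
      decide_eq_true_eq, List.mem_cons, exists_eq_or_imp]
    constructor
    · rintro ((⟨w, ⟨h₁, h₂⟩, h₃⟩ | h) | h)
      · exact .inr (.inl ⟨w, h₁, h₂, h₃.symm⟩)
      · exact .inl h
      · exact .inr (.inr h)
    · rintro (h | ⟨w, h₁, h₂, h₃⟩ | h)
      · exact .inl (.inr h)
      · exact .inl (.inl ⟨w, ⟨h₁, h₂⟩, h₃.symm⟩)
      · exact .inr h

/-! ### Correctness of the search steps -/

section Correctness

variable {r k : ℕ} {conf : Finset (Fin n) → Finset (Fin n) → Bool}
  {cands singles : List (Finset (Fin n))}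

theorem bad_eq_false {Q : Finset (Fin n)} {p : Part n} :
    bad conf Q p = false ↔ conf Q p.1 = false ∧ (p.2 = 0 → Q ≠ p.1) := by
  simp only [bad, Bool.or_eq_false_iff, Bool.and_eq_false_iff, decide_eq_false_iff_not]
  refine and_congr_right fun _ => ⟨fun h h0 he => ?_, fun h => ?_⟩
  · subst he; simp [h0] at h
  · by_cases h0 : p.2 = 0
    · right
      by_contra! h'
      exact h h0 (h'.1.antisymm h'.2)
    · exact .inl h0

theorem fits_eq_true {done rest : List (Part n)} {p : Part n} {Q : Finset (Fin n)} :
    fits conf done rest p Q = true ↔ p.1 ⊆ Q ∧ (p.2 = 0 → Q ⊆ p.1) ∧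
      (∀ q ∈ done, bad conf Q q = false) ∧ ∀ q ∈ rest, bad conf Q q = false := by
  simp only [fits, Bool.and_eq_true, decide_eq_true_eq, Bool.or_eq_true, Bool.not_eq_true',
    decide_eq_false_iff_not, Bool.or_eq_false_iff, List.any_eq_false, Bool.not_eq_true, and_assoc]
  rw [imp_iff_not_or]

theorem Setting.compat_symm (h : Setting r conf cands singles) {s t : Finset (Fin n)}
    (hst : Compat conf s t) : Compat conf t s := ⟨(h.symm t s).trans hst.1, hst.2.symm⟩

theorem Completes.eq_of_zero {s : Finset (Fin n)} {p : Part n} (h : Completes s p) (h0 : p.2 = 0) :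
    p.1 = s := Finset.eq_of_subset_of_card_le h.1 (by simpa [h0] using h.2)

theorem subset_expand {done pre rest : List (Part n)} {p : Part n} {wl : List (State n)} :
    wl ⊆ expand conf cands singles done pre p rest wl := by
  intro x hx
  unfold expand
  split
  · exact List.mem_cons_of_mem _ hx
  · split_ifs
    · exact hx
    · exact mem_branch.2 (.inl (List.mem_cons_of_mem _ hx))

theorem mem_fits {done rest : List (Part n)} {p : Part n} {Q : Finset (Fin n)}
    {l : List (Finset (Fin n))} (h : (cands.filter (fits conf done rest p)).reverse = Q :: l) :
    Q ∈ cands ∧ fits conf done rest p Q = true := by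
  have : Q ∈ (cands.filter (fits conf done rest p)).reverse := by simp [h]
  simpa using this

theorem Setting.exists_single (h : Setting r conf cands singles) {w : Finset (Fin n)}
    (hw : w ∈ singles) : ∃ i, w = {i} := by
  have := h.singles_perm.mem_iff.1 hw
  simp only [List.mem_map] at this
  obtain ⟨i, _, rfl⟩ := this
  exact ⟨i, rfl⟩

theorem Setting.single_mem (h : Setting r conf cands singles) (i : Fin n) : {i} ∈ singles :=
  h.singles_perm.mem_iff.2 (List.mem_map.2 ⟨i, List.mem_finRange i, rfl⟩)

/-- Bounds the number of children that one completion contributes; the singletons must be listed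
without repetition for this. -/
theorem Setting.length_filter (h : Setting r conf cands singles) (s : Finset (Fin n)) :
    (singles.filter fun w => decide (w ⊆ s)).length = s.card := by
  rw [(h.singles_perm.filter _).length_eq, List.filter_map, List.length_map]
  have : ((List.finRange n).filter (fun i => decide (i ∈ s))).toFinset = s := by ext; simp
  conv_rhs => rw [← this]
  rw [List.toFinset_card_of_nodup ((List.nodup_finRange n).filter _)]
  congr 2
  funext i
  simp

/-- A branching discards all completions, so the conditions on `done` become vacuous and only the
sizes remain to be checked. -/
theorem Good.fresh {q : State n} {p : Part n} {rest : List (Part n)}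
    (hq : Good r k conf cands q) (hr : q.rest = p :: rest) {p' : Part n}
    (hp : p'.1.card + p'.2 ≤ r) : Good r k conf cands (fresh p' (q.pre.reverse ++ rest)) where
  length_pre := rfl
  length := by
    have := hq.length
    have := hq.length_pre
    simp only [Search.fresh, List.length_nil, List.length_cons, List.length_append,
      List.length_reverse, hr] at *
    omega
  mem_cands := by simp [Search.fresh]
  pairwise := by simp [Search.fresh]
  not_bad := by simp [Search.fresh]
  card_pre := by simp [Search.fresh]
  card_rest := by
    intro x hx
    simp only [Search.fresh, List.mem_cons, List.mem_append, List.mem_reverse] at hx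
    rcases hx with rfl | hx | hx
    · exact hp
    · exact hq.card_pre x hx
    · exact hq.card_rest x (by rw [hr]; exact List.mem_cons_of_mem _ hx)

/-- A new completion was tested against `done` and against `rest`, which is what `pairwise` and
`not_bad` demand of it. -/
theorem Setting.good_expand (h : Setting r conf cands singles) {done pre rest : List (Part n)}
    {p : Part n} {wl : List (State n)} (hq : Good r k conf cands ⟨done, pre, p :: rest⟩)
    (hwl : ∀ x ∈ wl, Good r k conf cands x) :
    ∀ x ∈ expand conf cands singles done pre p rest wl, Good r k conf cands x := by
  intro x hx
  unfold expand at hx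
  have hp := hq.card_rest p (by simp)
  split at hx
  case _ Q l hQ =>
    obtain ⟨hc, hf⟩ := mem_fits hQ
    rw [fits_eq_true] at hf
    rcases List.mem_cons.1 hx with rfl | hx
    · have h₁ := hq.length_pre
      have h₂ := hq.length
      simp only [List.length_cons] at h₁ h₂
      refine ⟨by simp [h₁], by simp; omega, ?_, ?_, ?_, ?_, ?_⟩
      · simp only [List.mem_cons, forall_eq_or_imp]
        exact ⟨⟨trivial, hc⟩, hq.mem_cands⟩
      · simp only [List.map_cons, List.pairwise_cons, List.mem_map]
        refine ⟨?_, hq.pairwise⟩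
        rintro _ ⟨d, hd, rfl⟩
        -- Completions are stored with budget `0`, so not being `bad` includes being different.
        have := bad_eq_false.1 (hf.2.2.1 d hd)
        exact ⟨this.1, this.2 (hq.mem_cands d hd).1⟩
      · simp only [List.mem_cons, forall_eq_or_imp]
        exact ⟨hf.2.2.2, fun d hd p' hp' => hq.not_bad d hd p' (by simp [hp'])⟩
      · simp only [List.mem_cons, forall_eq_or_imp]
        exact ⟨hp, hq.card_pre⟩
      · exact fun p' hp' => hq.card_rest p' (by simp [hp'])
    · exact hwl x hx
  case _ =>
    split_ifs at hx with h0
    · exact hwl x hx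
    · rcases mem_branch.1 hx with hx | ⟨d, hd, w, hw, hwd, rfl⟩
      · rcases List.mem_cons.1 hx with rfl | hx
        · exact hq.fresh rfl (by simp only; omega)
        · exact hwl x hx
      · obtain ⟨i, rfl⟩ := h.exists_single hw
        have := Finset.card_union_le p.1 {i}
        rw [Finset.card_singleton] at this
        exact hq.fresh rfl (by simp only; omega)

/-- The members of the packing are rearranged along with the partial sets: `pre` is a stack, and the
changed set moves to the front. Compatibility is symmetric and hence insensitive to the order. -/
theorem Setting.alive_fresh (h : Setting r conf cands singles) {pre rest : List (Part n)}
    {p' : Part n} {A B : List (Finset (Fin n))} {s : Finset (Fin n)}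
    (hA : List.Forall₂ Completes A pre) (hB : List.Forall₂ Completes B rest)
    (hs : Completes s p') (hp : (A ++ s :: B).Pairwise (Compat conf))
    (hc : ∀ s' ∈ A ++ s :: B, s' ∈ cands) :
    Alive conf cands (fresh p' (pre.reverse ++ rest)) := by
  have hperm : (A ++ s :: B).Perm ([] ++ s :: (A.reverse ++ B)) :=
    List.perm_middle.trans (((List.reverse_perm A).symm.append_right B).cons s)
  exact ⟨[], s :: (A.reverse ++ B), .nil,
    .cons hs (List.rel_append (List.rel_reverse hA) hB),
    (hperm.pairwise_iff h.compat_symm).1 hp, fun s' hs' => hc s' (hperm.mem_iff.2 hs')⟩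

/-- The heart of the correctness proof: a set `s` of the packing that cannot be used now must share
with an earlier completion a vertex not yet in `p`, unless `p` already equals `s` and merely has
budget left. -/
theorem Setting.alive_expand (h : Setting r conf cands singles) {done pre rest : List (Part n)}
    {p : Part n} {wl : List (State n)} (hq : Good r k conf cands ⟨done, pre, p :: rest⟩)
    (ha : Alive conf cands ⟨done, pre, p :: rest⟩) :
    ∃ x ∈ expand conf cands singles done pre p rest wl, Alive conf cands x := by
  obtain ⟨A, B, hA, hB, hpw, hc⟩ := ha
  cases hB with
  | @cons s _ B _ hs hB =>
  unfold expand
  split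
  -- `Alive` ignores `done`: whatever `Q` was chosen, the same packing still witnesses it, and `s`
  -- only changes sides.
  case _ Q l hQ =>
    refine ⟨_, List.mem_cons_self, s :: A, B, .cons hs hA, hB, ?_, fun s' hs' => hc s' ?_⟩
    · exact (List.perm_middle.pairwise_iff h.compat_symm).1 hpw
    · exact List.perm_middle.mem_iff.2 hs'
  case _ hQ =>
    have hsc : s ∈ cands := hc s (by simp)
    have hscard := h.card_le s hsc
    have hnf : ¬ fits conf done rest p s = true := fun hf => by
      have : s ∈ (cands.filter (fits conf done rest p)).reverse := by simp [hsc, hf]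
      simp [hQ] at this
    -- Each remaining partial set lies in a member of the packing compatible with `s`, and equals
    -- that member if its budget is `0`.
    have hrest : ∀ p' ∈ rest, bad conf s p' = false := by
      intro p' hp'
      obtain ⟨t, ht, htp⟩ := exists_of_forall₂ hB hp'
      have hst : Compat conf s t :=
        List.rel_of_pairwise_cons (List.pairwise_append.1 hpw).2.1 ht
      have htc := h.card_le t (hc t (by simp [ht]))
      rw [bad_eq_false, h.symm]
      exact ⟨h.mono t s p'.1 htc hscard ((h.symm t s).trans hst.1) htp.1,
        fun h0 => by rw [htp.eq_of_zero h0]; exact hst.2⟩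
    rw [fits_eq_true] at hnf
    have hd : ∃ d ∈ done, bad conf s d = true := by
      by_contra! hd
      exact hnf ⟨hs.1, fun h0 => (hs.eq_of_zero h0).ge, fun q hq => by simpa using hd q hq, hrest⟩
    obtain ⟨d, hd, hbad⟩ := hd
    have hdb := bad_eq_false.1 (hq.not_bad d hd p (by simp))
    obtain ⟨hd0, hdc⟩ := hq.mem_cands d hd
    -- If `s` conflicts with `d`, the vertex comes from `ext`, since `d` does not conflict with
    -- `p.1`. Otherwise `s = d.1`, and any vertex of `s` missing from `p.1` will do; if none is
    -- missing, `not_bad` rules out budget `0`.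
    have key : (∃ v ∈ d.1, v ∈ s ∧ v ∉ p.1) ∨ (p.1 = s ∧ p.2 ≠ 0) := by
      by_cases hcf : conf s d.1 = true
      · obtain ⟨v, h₁, h₂, h₃⟩ := h.ext s d.1 p.1 hscard (h.card_le _ hdc) hcf hs.1
          ((h.symm _ _).trans hdb.1)
        exact .inl ⟨v, h₂, h₁, h₃⟩
      · have hsd : s = d.1 := by
          by_contra hne
          rw [bad_eq_false.2 ⟨by simpa using hcf, fun _ => hne⟩] at hbad
          simp at hbad
        by_cases hps : p.1 = s
        · exact .inr ⟨hps, fun h0 => hdb.2 h0 (by rw [hps, hsd])⟩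
        · obtain ⟨v, hv, hv'⟩ := Finset.exists_of_ssubset (hs.1.ssubset_of_ne hps)
          exact .inl ⟨v, hsd ▸ hv, hv, hv'⟩
    -- So a state that is dropped for lack of budget is never alive.
    have h0 : p.2 ≠ 0 := by
      rcases key with ⟨v, _, hv, hv'⟩ | ⟨_, h0⟩
      · exact fun h0 => hv' (hs.eq_of_zero h0 ▸ hv)
      · exact h0
    rw [if_neg h0]
    rcases key with ⟨v, hvd, hvs, hvp⟩ | ⟨hps, _⟩
    · refine ⟨_, mem_branch.2 (.inr ⟨d, hd, {v}, h.single_mem v, by simpa using hvd, rfl⟩),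
        h.alive_fresh hA hB ⟨?_, ?_⟩ hpw hc⟩
      · exact Finset.union_subset hs.1 (by simpa using hvs)
      · have := hs.2
        rw [Finset.card_union_of_disjoint (by simpa using hvp), Finset.card_singleton]
        simp only
        omega
    · exact ⟨_, mem_branch.2 (.inl List.mem_cons_self),
        h.alive_fresh hA hB ⟨hs.1, by simp [hps]⟩ hpw hc⟩

/-! ### The size of the search tree -/

/-- The number of nodes of a `b`-ary tree of height `B`. -/
def treeSize (b : ℕ) : ℕ → ℕ
  | 0 => 1
  | B + 1 => 1 + b * treeSize b B

theorem treeSize_pos (b B : ℕ) : 0 < treeSize b B := by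
  cases B <;> simp [treeSize]

theorem treeSize_mono {b B B' : ℕ} (h : B ≤ B') : treeSize b B ≤ treeSize b B' ∨ b = 0 := by
  rcases Nat.eq_zero_or_pos b with hb | hb
  · exact .inr hb
  · left
    induction h with
    | refl => exact le_rfl
    | step _ ih => exact ih.trans (by simp only [treeSize]; nlinarith [treeSize_pos b B])

theorem treeSize_self_le (b : ℕ) : treeSize b b ≤ 2 * b ^ b := by
  rcases Nat.lt_or_ge b 2 with hb | hb
  · interval_cases b <;> simp [treeSize]
  -- The summand `1` makes the induction work: the step needs `2 ≤ b`.
  · have : ∀ B, treeSize b B + 1 ≤ 2 * b ^ B := by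
      intro B
      induction B with
      | zero => simp [treeSize]
      | succ B ih => simp only [treeSize, pow_succ]; nlinarith
    exact Nat.le_of_succ_le (this b)

/-- The total budget. -/
def budget (l : List (Part n)) : ℕ := (l.map Prod.snd).sum

/-- A bound on the number of steps of the search below a state. -/
def weight (b k : ℕ) (q : State n) : ℕ :=
  (treeSize b (budget q.pre + budget q.rest) - 1) * (k + 1) + q.rest.length + 1

/-- The total weight of a list of states. -/
def total (b k : ℕ) (wl : List (State n)) : ℕ := (wl.map (weight b k)).sum

theorem total_cons (b k : ℕ) (q : State n) (wl : List (State n)) :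
    total b k (q :: wl) = weight b k q + total b k wl := by simp [total]

theorem total_append (b k : ℕ) (l wl : List (State n)) :
    total b k (l ++ wl) = total b k l + total b k wl := by simp [total]

theorem Setting.total_branch (h : Setting r conf cands singles) {p : Part n}
    {base done : List (Part n)} {wl : List (State n)} {b M : ℕ}
    (hM : ∀ w, weight b k (fresh (p.1 ∪ w, p.2 - 1) base) ≤ M) (hd : ∀ d ∈ done, d.1.card ≤ r) :
    total b k (branch singles p base done wl) ≤ done.length * r * M + total b k wl := by
  unfold branch
  induction done generalizing wl with
  | nil => simp
  | cons q done ih =>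
    rw [List.foldl_cons]
    refine (ih fun d hd' => hd d (by simp [hd'])).trans ?_
    rw [total_append, List.length_cons]
    have : total b k ((singles.filter fun w => decide (w ⊆ q.1)).map fun w =>
        fresh (p.1 ∪ w, p.2 - 1) base).reverse ≤ r * M := by
      unfold total
      refine (List.sum_le_card_nsmul _ M ?_).trans ?_
      · intro x hx
        simp only [List.mem_map, List.mem_reverse] at hx
        obtain ⟨_, ⟨w, _, rfl⟩, rfl⟩ := hx
        exact hM w
      · rw [List.length_map, List.length_reverse, List.length_map, h.length_filter, smul_eq_mul]
        exact Nat.mul_le_mul_right _ (hd q (by simp))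
    nlinarith

/-- In `weight`, the current greedy pass costs `rest.length + 1`, and each proper descendant in a
`b`-ary tree whose height is the total budget costs `k + 1`. A greedy step shortens the pass; a
branching pays for its children with one level of the tree. -/
theorem Setting.total_expand (h : Setting r conf cands singles) (hr : 1 ≤ r)
    {done pre rest : List (Part n)} {p : Part n} {wl : List (State n)}
    (hq : Good r k conf cands ⟨done, pre, p :: rest⟩) :
    total (r * k) k (expand conf cands singles done pre p rest wl) <
      total (r * k) k (⟨done, pre, p :: rest⟩ :: wl) := by
  rw [total_cons]
  unfold expand
  split
  · rw [total_cons]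
    have : budget (p :: pre) + budget rest = budget pre + budget (p :: rest) := by
      simp [budget]; ring
    simp only [weight, this, List.length_cons]
    omega
  · split_ifs with h0
    · simp [weight]
    · have hlen := hq.length
      have hlen' := hq.length_pre
      simp only [List.length_cons] at hlen hlen'
      have hk : 0 < k := by omega
      have hb : r * k ≠ 0 := by positivity
      -- As `p` has budget left, the total budget is a successor and `treeSize` unfolds once.
      obtain ⟨B, hB⟩ : ∃ B, budget pre + budget (p :: rest) = B + 1 :=
        ⟨budget pre + budget rest + p.2 - 1, by
          simp only [budget, List.map_cons, List.sum_cons]; omega⟩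
      have hw : ∀ p' : Part n, p'.2 + 1 ≤ p.2 →
          weight (r * k) k (fresh p' (pre.reverse ++ rest)) ≤ treeSize (r * k) B * (k + 1) := by
        intro p' hp'
        have hle : budget ([] : List (Part n)) + budget (p' :: (pre.reverse ++ rest)) ≤ B := by
          simp only [budget, List.map_cons, List.sum_cons, List.map_append, List.map_reverse,
            List.sum_append, List.sum_reverse, List.map_nil, List.sum_nil] at hB ⊢
          omega
        have := (treeSize_mono (b := r * k) hle).resolve_right hb
        have hpos := treeSize_pos (r * k) (budget ([] : List (Part n)) +
          budget (p' :: (pre.reverse ++ rest)))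
        simp only [weight, fresh, List.length_cons, List.length_append, List.length_reverse]
        obtain ⟨t, ht⟩ : ∃ t, treeSize (r * k) (budget ([] : List (Part n)) +
          budget (p' :: (pre.reverse ++ rest))) = t + 1 := ⟨_, (Nat.sub_add_cancel hpos).symm⟩
        rw [ht] at this ⊢
        calc (t + 1 - 1) * (k + 1) + (pre.length + rest.length + 1) + 1
            ≤ (t + 1) * (k + 1) := by rw [Nat.add_sub_cancel]; nlinarith
          _ ≤ _ := Nat.mul_le_mul_right _ this
      refine lt_of_le_of_lt (h.total_branch (fun w => hw _ (by simp only; omega)) fun d hd =>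
        h.card_le _ (hq.mem_cands d hd).2) ?_
      rw [total_cons]
      have h₁ := hw (p.1, 0) (by simp only; omega)
      have h₂ : weight (r * k) k ⟨done, pre, p :: rest⟩ =
          r * k * (treeSize (r * k) B * (k + 1)) + rest.length + 2 := by
        simp only [weight, hB, treeSize, List.length_cons]
        rw [Nat.add_sub_cancel_left]
        ring
      rw [h₂]
      -- Since `p` is not yet completed, `done` has at most `k - 1` members; the `r` thus saved pays
      -- for the child that declares `p` complete.
      have h₃ : done.length * r + 1 ≤ r * k := by
        have : done.length + 1 ≤ k := by omega
        nlinarith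
      have := Nat.mul_le_mul_right (treeSize (r * k) B * (k + 1)) h₃
      rw [Nat.add_mul, Nat.one_mul] at this
      omega

/-! ### Invariant and potential of the whole search -/

/-- The invariant of the search. -/
structure Inv (r k : ℕ) (conf : Finset (Fin n) → Finset (Fin n) → Bool)
    (cands : List (Finset (Fin n))) (x : Bool × List (State n)) : Prop where
  good : ∀ q ∈ x.2, Good r k conf cands q
  sound : x.1 = true → Packs conf cands k
  complete : Packs conf cands k → x.1 = true ∨ ∃ q ∈ x.2, Alive conf cands q

theorem Good.packs {done pre : List (Part n)} (hq : Good r k conf cands ⟨done, pre, []⟩) :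
    Packs conf cands k := by
  refine ⟨done.map Prod.fst, ?_, hq.pairwise, ?_⟩
  · have := hq.length
    simpa using this
  · intro s hs
    obtain ⟨d, hd, rfl⟩ := List.mem_map.1 hs
    exact (hq.mem_cands d hd).2

theorem Setting.inv_step (h : Setting r conf cands singles) (hr : 1 ≤ r)
    {x : Bool × List (State n)} (hx : Inv r k conf cands x) (hne : x.2 ≠ []) :
    Inv r k conf cands (step conf cands singles x) ∧
      total (r * k) k (step conf cands singles x).2 < total (r * k) k x.2 := by
  obtain ⟨a, wl⟩ := x
  rcases wl with _ | ⟨⟨done, pre, _ | ⟨p, rest⟩⟩, wl⟩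
  · simp at hne
  · have hq := hx.good ⟨done, pre, []⟩ (by simp)
    refine ⟨⟨by simp [step], fun _ => hq.packs, fun _ => .inl rfl⟩, ?_⟩
    simp [step, total, weight]
  · have hq := hx.good ⟨done, pre, p :: rest⟩ (by simp)
    refine ⟨⟨?_, hx.sound, fun hp => ?_⟩, h.total_expand hr hq⟩
    · exact h.good_expand hq fun q hq' => hx.good q (by simp [hq'])
    · rcases hx.complete hp with ha | ⟨q, hq', ha⟩
      · exact .inl ha
      · right
        rcases List.mem_cons.1 hq' with rfl | hq'
        · exact h.alive_expand hq ha
        · exact ⟨q, subset_expand hq', ha⟩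

/-- The root of the search tree. -/
def root (n r k : ℕ) : State n := ⟨[], [], List.replicate k (∅, r)⟩

/-- Every set of at most `r` vertices completes `(∅, r)`, so any packing witnesses that the root is
alive. -/
theorem Setting.inv_root (h : Setting r conf cands singles) :
    Inv r k conf cands (false, [root n r k]) := by
  refine ⟨?_, by simp, ?_⟩
  · intro q hq
    obtain rfl := List.mem_singleton.1 hq
    refine ⟨rfl, by simp [root], by simp [root], by simp [root], by simp [root], by simp [root], ?_⟩
    intro p hp
    rw [List.eq_of_mem_replicate hp]
    simp
  · rintro ⟨S, rfl, hp, hc⟩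
    refine .inr ⟨_, List.mem_singleton_self _, [], S, .nil, ?_, by simpa using hp,
      by simpa using hc⟩
    have hcard : ∀ s ∈ S, s.card ≤ r := fun s hs => h.card_le s (hc s hs)
    clear hp hc
    show List.Forall₂ Completes S (List.replicate S.length (∅, r))
    induction S with
    | nil => exact .nil
    | cons s S ih =>
      rw [List.length_cons, List.replicate_succ]
      exact .cons ⟨by simp, by simpa using hcard s (by simp)⟩
        (ih fun t ht => hcard t (by simp [ht]))

theorem total_root : total (r * k) k [root n r k] ≤ 2 * (r * k) ^ (r * k) * (k + 1) := by
  have : budget (List.replicate k ((∅ : Finset (Fin n)), r)) = r * k := by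
    simp [budget, mul_comm]
  have h0 : budget ([] : List (Part n)) = 0 := rfl
  have h := treeSize_self_le (r * k)
  have hp := treeSize_pos (r * k) (r * k)
  rw [total_cons]
  simp only [weight, root, total, List.map_nil, List.sum_nil, this, h0, Nat.zero_add,
    List.length_replicate]
  obtain ⟨t, ht⟩ : ∃ t, treeSize (r * k) (r * k) = t + 1 := ⟨_, (Nat.sub_add_cancel hp).symm⟩
  rw [ht] at h ⊢
  rw [Nat.add_sub_cancel]
  nlinarith

end Correctness

end Search

/-! ### The program for the search -/

namespace Search

/-- Encoding of a partial set. -/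
noncomputable def encPart {n : ℕ} (p : Part n) : Val := (encF p.1).cons (Val.ofNat p.2)

/-- Encoding of a state. -/
noncomputable def encState {n : ℕ} (q : State n) : Val :=
  (encList encPart q.done).cons ((encList encPart q.pre).cons (encList encPart q.rest))

/-- `U`, `I` and `A` compute unions, inclusions and the function `a` in time `M`. -/
structure Ops (U I A : Code) (n r : ℕ) (g : Val) (a : Finset (Fin n) → Finset (Fin n) → Bool)
    (M : ℕ) : Prop where
  union : ∀ s t : Finset (Fin n), Run U ((encF s).cons (encF t)) (encF (s ∪ t)) M
  subset : ∀ s t : Finset (Fin n),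
    Run I ((encF s).cons (encF t)) (Val.ofBool (decide (s ⊆ t))) M
  overlap : ∀ s t : Finset (Fin n), s.card ≤ r → t.card ≤ r →
    Run A (g.cons ((encF s).cons (encF t))) (Val.ofBool (a s t)) M
  pos : 1 ≤ M

theorem run_isZero {F : Code} {v : Val} {b S : ℕ} (h : Run F v (Val.ofNat b) S) :
    Run (F.ite Code.nil Code.true) v (Val.ofBool (decide (b = 0))) (S + 7) := by
  refine (Run.ite (T := 5) h (fun hb => ?_) fun hb => ?_).mono (by omega)
  · cases b with
    | zero => exact absurd rfl hb
    | succ => exact (Run.nil _).mono (by omega)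
  · cases b with
    | zero => exact (Run.true _).mono (by omega)
    | succ => simp [Val.ofNat, List.replicate_succ, Val.ofList] at hb

theorem run_pred {F : Code} {v : Val} {b S : ℕ} (h : Run F v (Val.ofNat b) S) :
    Run F.tl v (Val.ofNat (b - 1)) (S + 1) := by
  cases b <;> exact h.tl

theorem _root_.Run.congr {F : Code} {u v w : Val} {S T : ℕ} (h : Run F u v S) (hv : v = w)
    (hT : S ≤ T) : Run F u w T := hv ▸ h.mono hT

theorem _root_.Run.listCases {C F G : Code} {X : Type*} {enc : X → Val} {l : List X} {u v : Val}
    {S T : ℕ} (hC : Run C u (encList enc l) S) (hF : ∀ x l', l = x :: l' → Run F u v T)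
    (hG : l = [] → Run G u v T) : Run (Code.ite C F G) u v (S + T + 2) := by
  refine hC.ite (fun h => ?_) fun h => ?_
  · cases l with
    | nil => exact absurd rfl h
    | cons x l' => exact hF x l' rfl
  · cases l with
    | nil => exact hG rfl
    | cons x l' => simp [encList, Val.ofList] at h

variable (U I A : Code)

/-- The overlap function is not assumed symmetric, so it is evaluated in both orders. Constant
overhead is absorbed into the multiple of `M` because `1 ≤ M`. -/
theorem exists_run_bad : ∃ F, ∀ {n r : ℕ} {g : Val} {a : Finset (Fin n) → Finset (Fin n) → Bool}
    {M : ℕ}, Ops U I A n r g a M → ∀ (Q : Finset (Fin n)) (p : Part n), Q.card ≤ r →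
    p.1.card ≤ r → Run F ((g.cons (encF Q)).cons (encPart p))
      (Val.ofBool (bad (fun s t => a s t || a t s) Q p)) (200 * M) := by
  apply Exists.intro
  intro n r g a M h Q p hQ hp
  have hM := h.pos
  have hi := Run.id ((g.cons (encF Q)).cons (encPart p))
  exact (Run.or (Run.or ((hi.hd.hd.pair (hi.hd.tl.pair hi.tl.hd)).comp (h.overlap Q p.1 hQ hp))
      ((hi.hd.hd.pair (hi.tl.hd.pair hi.hd.tl)).comp (h.overlap p.1 Q hp hQ)))
    (Run.and (run_isZero hi.tl.tl) (Run.and ((hi.hd.tl.pair hi.tl.hd).comp (h.subset Q p.1))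
      ((hi.tl.hd.pair hi.hd.tl).comp (h.subset p.1 Q))))).mono (by omega)

theorem exists_run_fits : ∃ F, ∀ {n r : ℕ} {g : Val} {a : Finset (Fin n) → Finset (Fin n) → Bool}
    {M : ℕ}, Ops U I A n r g a M → ∀ (done rest : List (Part n)) (p : Part n) (Q : Finset (Fin n)),
    Q.card ≤ r → (∀ p ∈ done, p.1.card ≤ r) → (∀ p ∈ rest, p.1.card ≤ r) →
    Run F ((g.cons ((encPart p).cons ((encList encPart done).cons (encList encPart rest)))).cons
      (encF Q)) (Val.ofBool (fits (fun s t => a s t || a t s) done rest p Q))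
      (500 * ((done.length + rest.length + 1) * M)) := by
  obtain ⟨B, hB⟩ := exists_run_bad U I A
  apply Exists.intro
  intro n r g a M h done rest p Q hQ hd hr
  have hM := h.pos
  have hi := Run.id ((g.cons ((encPart p).cons ((encList encPart done).cons
    (encList encPart rest)))).cons (encF Q))
  have hi₁ := ((hi.hd.hd.pair hi.tl).pair hi.hd.tl.tl.hd).comp
    (Run.any done fun y hy => hB h Q y hQ (hd y hy))
  have hi₂ := ((hi.hd.hd.pair hi.tl).pair hi.hd.tl.tl.tl).comp
    (Run.any rest fun y hy => hB h Q y hQ (hr y hy))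
  refine (Run.and (Run.and ((hi.hd.tl.hd.hd.pair hi.tl).comp (h.subset p.1 Q))
      (Run.or (Run.not (run_isZero hi.hd.tl.hd.tl))
        ((hi.tl.pair hi.hd.tl.hd.hd).comp (h.subset Q p.1))))
    (Run.not (Run.or hi₁ hi₂))).mono ?_
  have h₁ : done.length ≤ done.length * M := Nat.le_mul_of_pos_right _ hM
  have h₂ : rest.length ≤ rest.length * M := Nat.le_mul_of_pos_right _ hM
  ring_nf at h₁ h₂ ⊢
  omega

theorem exists_run_branch : ∃ F, ∀ {n r : ℕ} {g : Val}
    {a : Finset (Fin n) → Finset (Fin n) → Bool} {M : ℕ}, Ops U I A n r g a M →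
    ∀ (singles : List (Finset (Fin n))) (p : Part n) (base done : List (Part n))
      (wl : List (State n)),
    Run F ((((encPart p).cons (encList encPart base)).cons (encList encF singles)).cons
        ((encList encState wl).cons (encList encPart done)))
      (encList encState (branch singles p base done wl))
      (400 * ((done.length + 1) * (singles.length + 1) * M)) := by
  apply Exists.intro
  intro n r g a M h singles p base done wl
  have hM := h.pos
  have hsub : ∀ q : Part n, ∀ w ∈ singles, Run _ _ _ (M + 20) := fun q w _ =>
    have hi := Run.id ((((encPart p).cons (encList encPart base)).cons (encF q.1)).cons (encF w))
    ((hi.tl.pair hi.hd.tl).comp (h.subset w q.1)).mono (by omega)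
  have hchild : ∀ q : Part n, ∀ w ∈ singles, decide (w ⊆ q.1) = true →
      Run _ _ (encState (fresh (p.1 ∪ w, p.2 - 1) base)) (M + 80) := fun q w _ _ =>
    have hi := Run.id ((((encPart p).cons (encList encPart base)).cons (encF q.1)).cons (encF w))
    ((Run.nil _).pair ((Run.nil _).pair ((((hi.hd.hd.hd.hd.pair hi.tl).comp
        (h.union p.1 w)).pair (run_pred (b := p.2) hi.hd.hd.hd.tl)).pair hi.hd.hd.tl))).mono
      (by omega)
  have hbody : ∀ (acc : List (State n)) (q : Part n), Run _ _ _ _ := fun acc q =>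
    have hi := Run.id ((((encPart p).cons (encList encPart base)).cons (encList encF singles)).cons
      ((encList encState acc).cons (encPart q)))
    ((hi.hd.hd.pair hi.tl.tl.hd).pair (hi.tl.hd.pair hi.hd.tl)).comp
      (Run.push (encA := encState) (g := fun w => fresh (p.1 ∪ w, p.2 - 1) base)
        singles (hsub q) (hchild q) acc)
  refine (Run.fold (encA := encList encState) (encY := encPart)
    done (fun acc q _ => hbody acc q) wl).mono ?_
  have h₁ : singles.length ≤ singles.length * M := Nat.le_mul_of_pos_right _ hM
  have h₂ : done.length * singles.length ≤ done.length * singles.length * M :=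
    Nat.le_mul_of_pos_right _ hM
  have h₃ : done.length ≤ done.length * M := Nat.le_mul_of_pos_right _ hM
  ring_nf at h₁ h₂ h₃ ⊢
  omega

theorem exists_run_expand : ∃ F, ∀ {n r : ℕ} {g : Val}
    {a : Finset (Fin n) → Finset (Fin n) → Bool} {M : ℕ}, Ops U I A n r g a M →
    ∀ (cands singles : List (Finset (Fin n))) (done pre : List (Part n)) (p : Part n)
      (rest : List (Part n)) (wl : List (State n)) (k : ℕ), done.length + rest.length ≤ k →
    pre.length ≤ k → (∀ s ∈ cands, s.card ≤ r) →
    (∀ p ∈ done, p.1.card ≤ r) → (∀ p ∈ rest, p.1.card ≤ r) →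
    Run F ((g.cons ((encList encF cands).cons (encList encF singles))).cons
        ((encState ⟨done, pre, p :: rest⟩).cons (encList encState wl)))
      (encList encState (expand (fun s t => a s t || a t s) cands singles done pre p rest wl))
      (2000 * ((cands.length + 1) * (singles.length + 1) * (k + 1) * M)) := by
  obtain ⟨Fi, hFi⟩ := exists_run_fits U I A
  obtain ⟨Br, hBr⟩ := exists_run_branch U I A
  apply Exists.intro
  intro n r g a M h cands singles done pre p rest wl k hk hpre hc hd hr
  have hM := h.pos
  have hi := Run.id ((g.cons ((encList encF cands).cons (encList encF singles))).cons
        ((encState ⟨done, pre, p :: rest⟩).cons (encList encState wl)))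
  -- Filtering by pushing reverses the list, which explains the `reverse` in `expand`.
  have hfl := ((hi.hd.hd.pair (hi.tl.hd.tl.tl.hd.pair (hi.tl.hd.hd.pair hi.tl.hd.tl.tl.tl))).pair
    ((Run.nil _).pair hi.hd.tl.hd)).comp (Run.push (encA := encF) cands (g := fun Q => Q)
      (fun Q hQ => (hFi h done rest p Q (hc Q hQ) hd hr).mono (T := 500 * ((k + 1) * M))
        (Nat.mul_le_mul_left _ (Nat.mul_le_mul_right _ (by omega))))
      (fun Q _ _ => (Run.id _).tl) [])
  rw [List.map_id', List.append_nil] at hfl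
  have hi' := Run.id ((encList encF (cands.filter
    (fits (fun s t => a s t || a t s) done rest p)).reverse).cons
    ((g.cons ((encList encF cands).cons (encList encF singles))).cons
      ((encState ⟨done, pre, p :: rest⟩).cons (encList encState wl))))
  -- Pushing the members of `pre` onto `rest` yields `pre.reverse ++ rest`, the original order of
  -- the partial sets.
  have hbase := ((Run.nil _).pair (hi'.tl.tl.hd.tl.tl.tl.pair hi'.tl.tl.hd.tl.hd)).comp
    (Run.map (encA := encPart) (G := Code.id.tl) (g := fun p => p) (e := Val.nil) (T := 2) pre
      (fun p _ => (Run.id _).tl) rest)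
  rw [List.map_id'] at hbase
  have hbr := (((hi'.tl.tl.hd.tl.tl.hd.pair hbase).pair hi'.tl.hd.tl.tl).pair
    ((((Run.nil _).pair ((Run.nil _).pair ((hi'.tl.tl.hd.tl.tl.hd.hd.pair (Run.nil _)).pair
      hbase))).pair hi'.tl.tl.tl).pair hi'.tl.tl.hd.hd)).comp
      (hBr h singles p (pre.reverse ++ rest) done (fresh (p.1, 0) (pre.reverse ++ rest) :: wl))
  have hT : 400 * ((done.length + 1) * (singles.length + 1) * M) ≤
      400 * ((singles.length + 1) * (k + 1) * M) := by
    have : (done.length + 1) * (singles.length + 1) ≤ (singles.length + 1) * (k + 1) := by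
      rw [mul_comm]; exact Nat.mul_le_mul_left _ (by omega)
    exact Nat.mul_le_mul_left _ (Nat.mul_le_mul_right _ this)
  have hk' : k + 1 ≤ (singles.length + 1) * (k + 1) * M :=
    (Nat.le_mul_of_pos_left _ (by omega)).trans (Nat.le_mul_of_pos_right _ hM)
  refine ((hfl.pair hi).comp (Run.listCases (T := 1000 * ((singles.length + 1) * (k + 1) * M))
    hi'.hd
    (fun Q l hQ => ((((hi'.hd.hd.pair (Run.nil _)).pair hi'.tl.tl.hd.hd).pair
      ((hi'.tl.tl.hd.tl.tl.hd.pair hi'.tl.tl.hd.tl.hd).pair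
        hi'.tl.tl.hd.tl.tl.tl)).pair hi'.tl.tl.tl).congr
          (by simp only [expand, hQ]; rfl) (by omega))
    (fun hQ => Run.cond (T := 900 * ((singles.length + 1) * (k + 1) * M))
      (run_isZero (b := p.2) hi'.tl.tl.hd.tl.tl.hd.tl)
      (fun h0 => hi'.tl.tl.tl.congr
        (by simp only [expand, hQ, if_pos (of_decide_eq_true h0)]; rfl) (by omega))
      (fun h0 => hbr.congr (by simp only [expand, hQ, if_neg (of_decide_eq_false h0)])
        (by omega)) |>.mono (by omega)))).mono ?_
  have h₁ : cands.length ≤ cands.length * ((singles.length + 1) * (k + 1) * M) :=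
    Nat.le_mul_of_pos_right _ (by omega)
  have h₂ : cands.length * ((k + 1) * M) ≤ cands.length * ((singles.length + 1) * (k + 1) * M) :=
    Nat.mul_le_mul_left _ (Nat.mul_le_mul_right _ (Nat.le_mul_of_pos_left _ (by omega)))
  have h₃ : (cands.length + 1) * (singles.length + 1) * (k + 1) * M =
    cands.length * ((singles.length + 1) * (k + 1) * M) + (singles.length + 1) * (k + 1) * M := by
      ring
  have h₄ : cands.length * (500 * ((k + 1) * M) + (1 + 1) + 80) =
    500 * (cands.length * ((k + 1) * M)) + cands.length * 82 := by ring
  rw [h₃, h₄]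
  omega

theorem exists_run_step : ∃ F, ∀ {n r : ℕ} {g : Val}
    {a : Finset (Fin n) → Finset (Fin n) → Bool} {M : ℕ}, Ops U I A n r g a M →
    ∀ (cands singles : List (Finset (Fin n))) (k : ℕ) (x : Bool × List (State n)),
    (∀ s ∈ cands, s.card ≤ r) → (∀ q ∈ x.2, Good r k (fun s t => a s t || a t s) cands q) →
    x.2 ≠ [] →
    Run F ((g.cons ((encList encF cands).cons (encList encF singles))).cons
        ((Val.ofBool x.1).cons (encList encState x.2)))
      ((g.cons ((encList encF cands).cons (encList encF singles))).cons
        ((Val.ofBool (step (fun s t => a s t || a t s) cands singles x).1).cons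
          (encList encState (step (fun s t => a s t || a t s) cands singles x).2)))
      (2100 * ((cands.length + 1) * (singles.length + 1) * (k + 1) * M)) := by
  obtain ⟨E, hE⟩ := exists_run_expand U I A
  refine ⟨Code.id.tl.tl.hd.tl.tl.ite
    (Code.id.hd.pair (Code.id.tl.hd.pair
      ((Code.id.hd.pair (Code.id.tl.tl.hd.pair Code.id.tl.tl.tl)).comp E)))
    (Code.id.hd.pair (Code.true.pair Code.nil)), ?_⟩
  intro n r g a M h cands singles k x hc hx hne
  have hM : 1 ≤ (cands.length + 1) * (singles.length + 1) * (k + 1) * M :=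
    Nat.mul_pos (by positivity) h.pos
  obtain ⟨b, wl⟩ := x
  have hi := Run.id ((g.cons ((encList encF cands).cons (encList encF singles))).cons
    ((Val.ofBool b).cons (encList encState wl)))
  rcases wl with _ | ⟨⟨done, pre, _ | ⟨p, rest⟩⟩, wl⟩
  · simp at hne
  · refine (Run.ite (T := 30) hi.tl.tl.hd.tl.tl (fun hn => absurd rfl hn) fun _ => ?_).mono
      (by omega)
    exact (hi.hd.pair ((Run.true _).pair (Run.nil _))).mono (by omega)
  · have hq := hx ⟨done, pre, p :: rest⟩ (by simp)
    have hl := hq.length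
    have hl' := hq.length_pre
    simp only [List.length_cons] at hl hl'
    have := hE h cands singles done pre p rest wl k (by omega) (by omega) hc
      (fun d hd => hc _ (hq.mem_cands d hd).2)
      (fun d hd => by have := hq.card_rest d (by simp [hd]); omega)
    refine (Run.ite (T := 2040 * ((cands.length + 1) * (singles.length + 1) * (k + 1) * M))
      hi.tl.tl.hd.tl.tl (fun _ => ?_) fun hn => ?_).mono ?_
    · exact (hi.hd.pair (hi.tl.hd.pair ((hi.hd.pair (hi.tl.tl.hd.pair hi.tl.tl.tl)).comp
        this))).mono (by omega)
    · exact absurd hn (by simp [encList, Val.ofList, encState, Val.hd, Val.tl])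
    · omega

/-- The search program. -/
theorem exists_run_search : ∃ F, ∀ {n r : ℕ} {g : Val}
    {a : Finset (Fin n) → Finset (Fin n) → Bool} {M : ℕ}, Ops U I A n r g a M → 1 ≤ r →
    ∀ (cands singles : List (Finset (Fin n))) (k : ℕ),
    Setting r (fun s t => a s t || a t s) cands singles →
    ∃ b : Bool, (b = true ↔ Packs (fun s t => a s t || a t s) cands k) ∧
    Run F ((g.cons ((encList encF cands).cons (encList encF singles))).cons
      ((Val.ofBool false).cons (encList encState [root n r k]))) (Val.ofBool b)
      (10000 * ((r * k) ^ (r * k) * (k + 1) ^ 2 *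
        ((cands.length + 1) * (singles.length + 1) * M))) := by
  obtain ⟨E, hE⟩ := exists_run_step U I A
  refine ⟨(Code.id.tl.tl.loop E).tl.hd, ?_⟩
  intro n r g a M h hr cands singles k hset
  -- The loop runs until the list of pending states is empty, which `step` also brings about on
  -- success; the total weight bounds the number of passes.
  obtain ⟨⟨b, wl⟩, hy, hy', hrun⟩ := Run.loop
    (fun x : Bool × List (State n) => (g.cons ((encList encF cands).cons
      (encList encF singles))).cons ((Val.ofBool x.1).cons (encList encState x.2)))
    (fun x => encList encState x.2) (step (fun s t => a s t || a t s) cands singles)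
    (Inv r k (fun s t => a s t || a t s) cands) (fun x => total (r * k) k x.2)
    (fun x _ => (Run.id _).tl.tl)
    (fun x hx hne =>
      have hne' : x.2 ≠ [] := fun h0 => hne (by rw [h0]; rfl)
      ⟨hE h cands singles k x hset.card_le hx.good hne', hset.inv_step hr hx hne'⟩)
    (false, [root n r k]) hset.inv_root
  have hwl : wl = [] := by
    cases wl with
    | nil => rfl
    | cons => simp [encList, Val.ofList] at hy'
  subst hwl
  refine ⟨b, ⟨hy.sound, fun hp => ?_⟩, hrun.tl.hd.mono ?_⟩
  · rcases hy.complete hp with h | ⟨q, hq, _⟩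
    · exact h
    · simp at hq
  · have ht := total_root (n := n) (r := r) (k := k)
    have hM := h.pos
    have hp : 1 ≤ (r * k) ^ (r * k) := by
      rcases Nat.eq_zero_or_pos (r * k) with h0 | h0
      · simp [h0]
      · exact Nat.pow_pos h0
    set X := (cands.length + 1) * (singles.length + 1) with hX
    have hX1 : 1 ≤ X := Nat.mul_pos (by omega) (by omega)
    set Y := (r * k) ^ (r * k)
    have hY : total (r * k) k [root n r k] + 1 ≤ 3 * (Y * (k + 1)) := by nlinarith
    have hZ : 1 ≤ X * (k + 1) * M := Nat.mul_pos (Nat.mul_pos hX1 (by omega)) hM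
    have hW : 1 ≤ Y * (k + 1) := Nat.mul_pos hp (by omega)
    calc _ ≤ 3 * (Y * (k + 1)) * (2105 * (X * (k + 1) * M)) + 2 := by
          have := Nat.mul_le_mul hY (show 1 + 1 + 1 + 2100 * (X * (k + 1) * M) + 2 ≤
            2105 * (X * (k + 1) * M) by omega)
          exact Nat.add_le_add_right this 2
      _ ≤ 10000 * (Y * (k + 1) * (X * (k + 1) * M)) := by nlinarith
      _ = _ := by ring

end Search

/-! ### Enumeration of the small sets -/

/-- The characteristic vectors of the singletons, in some order. -/
def singleVecs : ℕ → List (List Bool)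
  | 0 => []
  | n + 1 => ((singleVecs n).map (false :: ·)).reverse ++ [true :: List.replicate n false]

theorem vec_injective (n : ℕ) : Function.Injective (vec : Finset (Fin n) → List Bool) := by
  intro s t h
  ext i
  have := congrFun (List.ofFn_injective h) i
  simpa using this

theorem vec_empty (n : ℕ) : vec (∅ : Finset (Fin n)) = List.replicate n false := by
  simp [vec]

theorem singleVecs_perm (n : ℕ) :
    (singleVecs n).Perm ((List.finRange n).map fun i => vec {i}) := by
  induction n with
  | zero => simp [singleVecs]
  | succ n ih =>
    have h₀ : vec {(0 : Fin (n + 1))} = true :: List.replicate n false := by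
      simp [vec, List.ofFn_succ]
    have h₁ : ∀ i : Fin n, vec {i.succ} = false :: vec {i} := by
      intro i
      simp [vec, List.ofFn_succ, (Fin.succ_ne_zero i).symm]
    rw [singleVecs, List.finRange_succ, List.map_cons, List.map_map, h₀]
    refine (List.perm_append_singleton _ _).trans (List.Perm.cons _ ?_)
    refine (List.reverse_perm _).trans ?_
    have : (fun i : Fin (n + 1) => vec {i}) ∘ Fin.succ = (false :: ·) ∘ fun i : Fin n => vec {i} :=
      funext h₁
    rw [this, ← List.map_map]
    exact ih.map _

/-- The singletons, in the order of `singleVecs`. -/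
theorem exists_singles (n : ℕ) : ∃ L : List (Finset (Fin n)), L.map vec = singleVecs n ∧
    L.Perm ((List.finRange n).map fun i => {i}) := by
  have h : singleVecs n ∈ Set.range (List.map (vec : Finset (Fin n) → List Bool)) := by
    rw [Set.range_list_map]
    intro u hu
    obtain ⟨i, _, rfl⟩ := List.mem_map.1 ((singleVecs_perm n).mem_iff.1 hu)
    exact ⟨_, rfl⟩
  obtain ⟨L, hL⟩ := h
  refine ⟨L, hL, (List.map_perm_map_iff (vec_injective n)).1 ?_⟩
  rw [hL, List.map_map]
  exact singleVecs_perm n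

/-- From any list of length `n`, the empty set and the singletons are computed. -/
theorem exists_run_singles : ∃ F, ∀ (n : ℕ) (l : List Val), l.length = n →
    ∃ L : List (Finset (Fin n)), L.Perm ((List.finRange n).map fun i => {i}) ∧
      Run F (Val.ofList l) ((encF (∅ : Finset (Fin n))).cons (encList encF L))
        (1000 * (n + 1) ^ 2) := by
  apply Exists.intro
  intro n l hl
  obtain ⟨L, hL, hperm⟩ := exists_singles n
  refine ⟨L, hperm, ?_⟩
  have key : ∀ (l : List Val) (m : ℕ), l.foldl (fun (a : List Bool × List (List Bool)) _ =>
      (false :: a.1, (a.2.map (false :: ·)).reverse ++ [true :: a.1]))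
      (List.replicate m false, singleVecs m) =
        (List.replicate (m + l.length) false, singleVecs (m + l.length)) := by
    intro l
    induction l with
    | nil => simp
    | cons y l ih =>
      intro m
      rw [List.foldl_cons, List.length_cons, ← Nat.add_assoc, Nat.add_right_comm, ← ih (m + 1)]
      rfl
  have hbody : ∀ (a : List Bool × List (List Bool)) (y : Val), Run _ _ _ _ := fun a y =>
    have hi := Run.id (Val.nil.cons (((encList Val.ofBool a.1).cons
      (encList (encList Val.ofBool) a.2)).cons y))
    (((Run.nil _).pair hi.tl.hd.hd).pair
      (((Run.nil _).pair ((((Run.true _).pair hi.tl.hd.hd).pair (Run.nil _)).pair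
        hi.tl.hd.tl)).comp
        (Run.map (encA := encList Val.ofBool) (encY := encList Val.ofBool)
          (g := (false :: ·)) (e := Val.nil) a.2
          (fun u _ => (Run.nil _).pair (Run.id _).tl) [true :: a.1])))
  -- The singletons found so far and the remaining list entries number at most `n` together, so each
  -- pass is linear in `n` and the whole fold quadratic.
  have hfold := Run.fold_of_inv (encA := fun a : List Bool × List (List Bool) =>
      (encList Val.ofBool a.1).cons (encList (encList Val.ofBool) a.2))
    (encY := fun v : Val => v) (T := 91 * n + 200) (e := Val.nil)
    (f := fun a _ => (false :: a.1, (a.2.map (false :: ·)).reverse ++ [true :: a.1]))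
    (fun l' a => a.2.length + l'.length ≤ n) l
    (fun a y l' ha _ => ⟨by simp at ha ⊢; omega, (hbody a y).mono (by simp at ha; omega)⟩)
    ([], []) (by simp [hl])
  have h0 := key l 0
  rw [Nat.zero_add, hl] at h0
  have h0' : l.foldl (fun (a : List Bool × List (List Bool)) _ =>
      (false :: a.1, (a.2.map (false :: ·)).reverse ++ [true :: a.1])) ([], []) = _ := h0
  rw [h0'] at hfold
  have hL' : encList encF L = encList (encList Val.ofBool) (singleVecs n) := by
    rw [← hL]
    simp only [encList, List.map_map]
    congr 1
    exact List.map_congr_left fun s _ => encF_eq s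
  rw [encF_eq, vec_empty, hL']
  have hv : encList (fun v : Val => v) l = Val.ofList l := by simp [encList]
  rw [hv] at hfold
  exact (((Run.nil (Val.ofList l)).pair
    (((Run.nil _).pair (Run.nil _)).pair (Run.id _))).comp hfold).mono (by rw [hl]; nlinarith)

/-- All unions of at most `j` members of the list, with repetitions. -/
def unions {n : ℕ} (singles : List (Finset (Fin n))) : ℕ → List (Finset (Fin n))
  | 0 => [∅]
  | j + 1 => (unions singles j).foldl (fun acc s => (singles.map (s ∪ ·)).reverse ++ acc)
      (unions singles j)

theorem mem_foldl_append {A B : Type*} (f : A → List B) (l : List A) (acc : List B) (x : B) :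
    x ∈ l.foldl (fun acc s => f s ++ acc) acc ↔ x ∈ acc ∨ ∃ s ∈ l, x ∈ f s := by
  induction l generalizing acc with
  | nil => simp
  | cons s l ih =>
    rw [List.foldl_cons, ih]
    simp only [List.mem_append, List.mem_cons, exists_eq_or_imp]
    tauto

theorem length_foldl_append {A B : Type*} (f : A → List B) (l : List A) (acc : List B) (N : ℕ)
    (h : ∀ s, (f s).length = N) :
    (l.foldl (fun acc s => f s ++ acc) acc).length = l.length * N + acc.length := by
  induction l generalizing acc with
  | nil => simp
  | cons s l ih => rw [List.foldl_cons, ih, List.length_append, h, List.length_cons]; ring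

theorem mem_unions {n : ℕ} {singles : List (Finset (Fin n))}
    (h : singles.Perm ((List.finRange n).map fun i => {i})) (j : ℕ) (s : Finset (Fin n)) :
    s ∈ unions singles j ↔ s.card ≤ j := by
  have hs : ∀ w, w ∈ singles ↔ ∃ i, w = {i} := fun w => by
    rw [h.mem_iff]; simp [eq_comm]
  induction j generalizing s with
  | zero => simp [unions]
  | succ j ih =>
    rw [unions, mem_foldl_append (fun s => (singles.map (s ∪ ·)).reverse)]
    simp only [List.mem_reverse, List.mem_map, ih, hs]
    constructor
    · rintro (h | ⟨t, ht, _, ⟨i, rfl⟩, rfl⟩)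
      · omega
      · have := Finset.card_union_le t {i}
        rw [Finset.card_singleton] at this
        omega
    · intro hc
      rcases s.eq_empty_or_nonempty with rfl | ⟨i, hi⟩
      · simp
      · refine .inr ⟨s.erase i, ?_, {i}, ⟨i, rfl⟩, ?_⟩
        · rw [Finset.card_erase_of_mem hi]; omega
        · rw [Finset.union_comm, ← Finset.insert_eq, Finset.insert_erase hi]

theorem length_unions {n : ℕ} (singles : List (Finset (Fin n))) (j : ℕ) :
    (unions singles j).length = (singles.length + 1) ^ j := by
  induction j with
  | zero => simp [unions]
  | succ j ih =>
    rw [unions, length_foldl_append (fun s => (singles.map (s ∪ ·)).reverse) _ _ singles.length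
      (by simp), ih]
    ring

/-- Since `r` is a constant of the problem, the program may depend on `j`: each stage appends one
more double loop to the code of the previous one. -/
theorem exists_run_unions (U : Code) (j : ℕ) : ∃ F, ∀ (n M : ℕ) (singles : List (Finset (Fin n))),
    1 ≤ M → (∀ s t : Finset (Fin n), Run U ((encF s).cons (encF t)) (encF (s ∪ t)) M) →
    Run F ((encF (∅ : Finset (Fin n))).cons (encList encF singles))
      (encList encF (unions singles j)) (500 * ((j + 1) * (singles.length + 1) ^ j * M)) := by
  induction j with
  | zero =>
    apply Exists.intro
    intro n M singles hM _
    exact ((Run.id ((encF (∅ : Finset (Fin n))).cons (encList encF singles))).hd.pair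
      (Run.nil _)).mono (by simp; omega)
  | succ j ih =>
    obtain ⟨E, hE⟩ := ih
    apply Exists.intro
    intro n M singles hM hU
    have hE := hE n M singles hM hU
    have hbody : ∀ (acc : List (Finset (Fin n))) (s : Finset (Fin n)), Run _ _ _ _ := fun acc s =>
      have hi := Run.id ((encList encF singles).cons ((encList encF acc).cons (encF s)))
      (hi.tl.tl.pair (hi.tl.hd.pair hi.hd)).comp
        (Run.map (encA := encF) (encY := encF) (e := encF s) (g := (s ∪ ·)) singles
          (fun w _ => hU s w) acc)
    have hi := Run.id ((encF (∅ : Finset (Fin n))).cons (encList encF singles))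
    have hi' := Run.id ((encList encF (unions singles j)).cons (encList encF singles))
    refine (((hE.pair hi.tl).comp ((hi'.tl.pair (hi'.hd.pair hi'.hd)).comp
      (Run.fold (encA := encList encF) (encY := encF) (unions singles j)
        (fun acc s _ => hbody acc s) (unions singles j))))).mono ?_
    rw [length_unions]
    set N := singles.length
    set Y := (N + 1) ^ j with hY
    have hY1 : 1 ≤ Y := Nat.pow_pos (by omega)
    have h₁ : Y ≤ Y * M := Nat.le_mul_of_pos_right _ hM
    have h₂ : Y * N ≤ Y * N * M := Nat.le_mul_of_pos_right _ hM
    have h₃ : 500 * ((j + 1 + 1) * (N + 1) ^ (j + 1) * M) = 500 * ((j + 1) * Y * M) +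
      500 * (j * (Y * N * M)) + 1000 * (Y * N * M) + 500 * (Y * M) := by rw [pow_succ]; ring
    rw [h₃]
    ring_nf at h₁ h₂ ⊢
    omega

/-! ### The packing problem -/

open Search

section Packing

variable {n r d k : ℕ} {α : OverlapFn} {P : SubgraphProp} {G : SimpleGraph (Fin n)}

/-- For `ext`, the second condition is applied with one of the two sets unshrunk: a vertex of `s ∩
t` outside `s' ∩ t` lies outside `s'`. Which order of the arguments is used depends on which one
conflicts. -/
theorem WellConditioned.setting (hα : WellConditioned r d α) (G : SimpleGraph (Fin n))
    {cands singles : List (Finset (Fin n))} (hc : ∀ s ∈ cands, s.card ≤ r)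
    (hs : singles.Perm ((List.finRange n).map fun i => {i})) :
    Setting r (fun s t : Finset (Fin n) => α n G s t || α n G t s) cands singles where
  symm s t := Bool.or_comm _ _
  card_le := hc
  mono s t s' h₁ h₂ h h' := by
    rw [← Set.ncard_coe_finset] at h₁ h₂
    rw [Bool.or_eq_false_iff] at h ⊢
    exact ⟨hα.hereditary n G s t s' t h₁ h₂ h.1 (by simpa using h') subset_rfl,
      hα.hereditary n G t s t s' h₂ h₁ h.2 subset_rfl (by simpa using h')⟩
  ext s t s' h₁ h₂ h h' h₀ := by
    rw [← Set.ncard_coe_finset] at h₁ h₂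
    rw [Bool.or_eq_false_iff] at h₀
    rcases Bool.or_eq_true_iff.1 h with h | h
    · obtain ⟨v, hv, hv'⟩ := (hα.overlap n G s t h₁ h₂ h).2 s' t (by simpa using h') subset_rfl h₀.1
      exact ⟨v, hv.1, hv.2, fun h => hv' ⟨h, hv.2⟩⟩
    · obtain ⟨v, hv, hv'⟩ := (hα.overlap n G t s h₂ h₁ h).2 t s' subset_rfl (by simpa using h') h₀.2
      exact ⟨v, hv.2, hv.1, fun h => hv' ⟨hv.1, h⟩⟩
  singles_perm := hs

/-- An induced subgraph is determined by its vertex set. The packing condition ranges over ordered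
pairs and so matches the symmetrised conflict; a packing with more than `k` members is cut down to
`k`. -/
theorem packs_iff {cands : List (Finset (Fin n))}
    (hc : ∀ s : Finset (Fin n), s ∈ cands ↔
      s.card ≤ r ∧ P n G ((⊤ : G.Subgraph).induce (s : Set (Fin n)))) :
    Packs (fun s t : Finset (Fin n) => α n G s t || α n G t s) cands k ↔ HasPacking r P α G k := by
  classical
  constructor
  · rintro ⟨S, hk, hp, hS⟩
    have hinj : Function.Injective fun s : Finset (Fin n) =>
        (⊤ : G.Subgraph).induce (s : Set (Fin n)) := fun s t h => by
      simpa using congrArg SimpleGraph.Subgraph.verts h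
    refine ⟨S.toFinset.image fun s : Finset (Fin n) =>
      (⊤ : G.Subgraph).induce (s : Set (Fin n)), ?_, ?_, ?_⟩
    · rw [Finset.card_image_of_injective _ hinj, List.toFinset_card_of_nodup, hk]
      exact hp.imp fun h => h.2
    · intro H hH
      obtain ⟨s, hs, rfl⟩ := Finset.mem_image.1 hH
      have := (hc s).1 (hS s (List.mem_toFinset.1 hs))
      exact ⟨SimpleGraph.Subgraph.isInduced_iff_exists_eq_induce_top _ |>.2 ⟨_, rfl⟩,
        by simpa using this.1, this.2⟩
    · intro H hH H' hH' hne
      obtain ⟨s, hs, rfl⟩ := Finset.mem_image.1 hH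
      obtain ⟨t, ht, rfl⟩ := Finset.mem_image.1 hH'
      have : Std.Symm (Compat fun s t : Finset (Fin n) => α n G s t || α n G t s) :=
        ⟨fun _ _ h => ⟨(Bool.or_comm _ _).trans h.1, h.2.symm⟩⟩
      have := hp.forall (List.mem_toFinset.1 hs) (List.mem_toFinset.1 ht)
        (fun h => hne (by rw [h]))
      exact (Bool.or_eq_false_iff.1 this.1).1
  · rintro ⟨K, hk, hK, hpw⟩
    obtain ⟨K', hK', hcard⟩ := Finset.exists_subset_card_eq hk
    have hv : ∀ H : G.Subgraph, ((H.verts.toFinset : Finset (Fin n)) : Set (Fin n)) = H.verts :=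
      fun H => by simp
    have hmem : ∀ H ∈ K'.toList, H ∈ K := fun H hH => hK' (by simpa using hH)
    refine ⟨K'.toList.map fun H => H.verts.toFinset, by simp [hcard], ?_, ?_⟩
    · rw [List.pairwise_map]
      refine K'.nodup_toList.pairwise_of_forall_ne fun H hH H' hH' hne => ⟨?_, fun h => hne ?_⟩
      · simp only [hv, hpw H (hmem H hH) H' (hmem H' hH') hne,
          hpw H' (hmem H' hH') H (hmem H hH) hne.symm, Bool.or_self]
      · rw [← (hK H (hmem H hH)).1.induce_top_verts, ← (hK H' (hmem H' hH')).1.induce_top_verts,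
          ← hv H, ← hv H', h]
    · intro s hs
      obtain ⟨H, hH, rfl⟩ := List.mem_map.1 hs
      obtain ⟨h₁, h₂, h₃⟩ := hK H (hmem H hH)
      rw [hc, hv, h₁.induce_top_verts]
      refine ⟨?_, h₃⟩
      rwa [← Set.ncard_coe_finset, hv]

/-- The preparatory computations followed by the search. -/
theorem exists_run_packing (U I A V : Code) (r : ℕ) (hr : 1 ≤ r) :
    ∃ F C, ∀ (n M k : ℕ) (l : List Val)
      (a : Finset (Fin n) → Finset (Fin n) → Bool) (p : Finset (Fin n) → Bool),
    l.length = n → Ops U I A n r (Val.ofList l) a M →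
    (∀ s : Finset (Fin n), s.card ≤ r → Run V ((Val.ofList l).cons (encF s)) (Val.ofBool (p s)) M) →
    (∀ cands singles : List (Finset (Fin n)), (∀ s ∈ cands, s.card ≤ r) →
      singles.Perm ((List.finRange n).map fun i => {i}) →
      Setting r (fun s t => a s t || a t s) cands singles) →
    ∃ cands : List (Finset (Fin n)), (∀ s, s ∈ cands ↔ s.card ≤ r ∧ p s = true) ∧
    ∃ b : Bool, (b = true ↔ Packs (fun s t => a s t || a t s) cands k) ∧
      Run F ((Val.ofList l).cons (Val.ofNat k)) (Val.ofBool b)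
        (C * ((r * k) ^ (r * k) * (k + 1) ^ 2 * (((n + 1) ^ r + 1) * (n + 1) * M))) := by
  obtain ⟨Si, hSi⟩ := exists_run_singles
  obtain ⟨En, hEn⟩ := exists_run_unions U r
  obtain ⟨Se, hSe⟩ := exists_run_search U I A
  obtain ⟨Tr, hTr⟩ := Run.const (Val.ofNat r)
  apply Exists.intro
  -- The first `1000` is for the singletons, `500 * (r + 1)` for the unions, `Tr` for writing the
  -- budgets of the root and `10000` for the search; the rest absorbs filtering and overhead.
  refine ⟨1000 + 500 * (r + 1) + 1000 + Tr + 500 + 10000, ?_⟩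
  intro n M k l a p hl hops hV hset
  have hM := hops.pos
  obtain ⟨singles, hperm, hsing⟩ := hSi n l hl
  have hlen : singles.length = n := by simpa using hperm.length_eq
  have hun := hEn n M singles hM hops.union
  have hmem := mem_unions hperm r
  have hcands : ∀ s, s ∈ (((unions singles r).filter p).map fun s => s).reverse ++ [] ↔
      s.card ≤ r ∧ p s = true := fun s => by simp [hmem]
  have hclen : ((((unions singles r).filter p).map fun s => s).reverse ++ []).length ≤
      (n + 1) ^ r := by
    have := List.length_filter_le p (unions singles r)
    rw [length_unions, hlen] at this
    simpa using this
  obtain ⟨b, hb, hrun⟩ := hSe hops hr _ singles k (hset _ singles (fun s hs => ((hcands s).1 hs).1)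
    hperm)
  refine ⟨_, hcands, b, hb, ?_⟩
  have hi := Run.id ((Val.ofList l).cons (Val.ofNat k))
  have hj := Run.id (((encF (∅ : Finset (Fin n))).cons (encList encF singles)).cons
    ((Val.ofList l).cons (Val.ofNat k)))
  have hfil := (hj.tl.hd.pair ((Run.nil _).pair (hj.hd.comp hun))).comp
    (Run.push (encA := encF) (encY := encF) (g := fun s => s) (unions singles r)
      (fun s hs => hV s ((hmem s).1 hs)) (fun s _ _ => (Run.id _).tl) [])
  -- In unary, `k` is a list of length `k`; mapping over it creates the `k` empty parts of the root.
  have hnat : Val.ofNat k = encList (fun _ : Unit => Val.nil) (List.replicate k ()) := by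
    simp [Val.ofNat, encList]
  have hroot := (hj.hd.hd.pair ((Run.nil _).pair hj.tl.tl)).comp
    (hnat ▸ Run.map (encA := encPart) (encY := fun _ : Unit => Val.nil)
      (e := encF (∅ : Finset (Fin n))) (g := fun _ => (∅, r)) (List.replicate k ())
      (fun _ _ => (Run.id _).hd.pair (hTr _)) [])
  rw [List.map_replicate, List.reverse_replicate, List.append_nil] at hroot
  refine ((((hi.hd.comp hsing).pair hi).comp (((hj.tl.hd.pair (hfil.pair hj.hd.tl)).pair
    ((Run.nil _).pair (((Run.nil _).pair ((Run.nil _).pair hroot)).pair (Run.nil _)))).comp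
    hrun))).mono ?_
  rw [length_unions, hlen, List.length_replicate]
  set Y := (r * k) ^ (r * k)
  set N := (n + 1) ^ r
  have hY' : 1 ≤ Y := by
    rcases Nat.eq_zero_or_pos (r * k) with h | h
    · simp [Y, h]
    · exact Nat.pow_pos h
  have hY : 1 ≤ Y * (k + 1) ^ 2 := Nat.mul_pos hY' (by positivity)
  have hN : n + 1 ≤ N := Nat.le_self_pow (by omega) _
  have hNM : N * M ≤ (N + 1) * (n + 1) * M :=
    Nat.mul_le_mul_right _ (N.le_succ.trans (Nat.le_mul_of_pos_right _ (by omega)))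
  set Z := Y * (k + 1) ^ 2 * ((N + 1) * (n + 1) * M) with hZ
  have hXZ : (N + 1) * (n + 1) * M ≤ Z := Nat.le_mul_of_pos_left _ hY
  have z₁ : (n + 1) ^ 2 ≤ Z := by
    refine le_trans ?_ hXZ
    rw [pow_two]
    exact (Nat.mul_le_mul_right _ (by omega)).trans (Nat.le_mul_of_pos_right _ hM)
  have z₂ : N * M ≤ Z := hNM.trans hXZ
  have z₃ : N ≤ N * M := Nat.le_mul_of_pos_right _ hM
  have z₄ : k + 1 ≤ Z := by
    have : k + 1 ≤ Y * (k + 1) ^ 2 :=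
      (Nat.le_self_pow two_ne_zero _).trans (Nat.le_mul_of_pos_left _ hY')
    exact this.trans (Nat.le_mul_of_pos_right _ (by positivity))
  have z₅ : k * Tr ≤ Tr * Z := by rw [mul_comm]; exact Nat.mul_le_mul_left _ (by omega)
  have z₆ := Nat.mul_le_mul_left (Y * (k + 1) ^ 2) (Nat.mul_le_mul_right M
    (Nat.mul_le_mul_right (n + 1) (Nat.add_le_add_right hclen 1)))
  rw [← hZ] at z₆
  have z₇ : (r + 1) * N * M ≤ (r + 1) * Z := by
    rw [mul_assoc]; exact Nat.mul_le_mul_left _ z₂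
  ring_nf at z₁ z₂ z₃ z₅ z₆ z₇ ⊢
  omega

/-- The arithmetic of the running time. -/
theorem time_le {r n k m d : ℕ} (hr : 1 ≤ r) (hn : 0 < n) :
    (r * k) ^ (r * k) * (k + 1) ^ 2 * (((n + 1) ^ r + 1) * (n + 1) * (m * n ^ (d + 1))) ≤
      4 * (2 ^ r + 1) * 2 * m * (r ^ (r * k) * k ^ ((r + 1) * k) * n ^ ((d + 3) * r)) := by
  -- The polynomial factor in `k` is absorbed here; this raises the exponent from `r * k` to `(r +
  -- 1) * k`.
  have h₁ : (k + 1) ^ 2 ≤ 4 * k ^ k := by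
    rcases Nat.lt_or_ge k 2 with hk | hk
    · interval_cases k <;> simp
    · calc (k + 1) ^ 2 ≤ (2 * k) ^ 2 := Nat.pow_le_pow_left (by omega) 2
        _ = 4 * k ^ 2 := by ring
        _ ≤ 4 * k ^ k := Nat.mul_le_mul_left _ (Nat.pow_le_pow_right (by omega) hk)
  have h₂ : (n + 1) ^ r + 1 ≤ (2 ^ r + 1) * n ^ r := by
    have h : (n + 1) ^ r ≤ (2 * n) ^ r := Nat.pow_le_pow_left (by omega) r
    rw [mul_pow] at h
    have : 1 ≤ n ^ r := Nat.pow_pos hn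
    nlinarith
  -- The exponent is `r + d + 2`, at most `(d + 3) * r` because `1 ≤ r`.
  have h₃ : n ^ r * n * n ^ (d + 1) ≤ n ^ ((d + 3) * r) := by
    rw [← pow_succ, ← pow_add]
    exact Nat.pow_le_pow_right hn (by nlinarith)
  calc _ ≤ (r * k) ^ (r * k) * (4 * k ^ k) *
        ((2 ^ r + 1) * n ^ r * (2 * n) * (m * n ^ (d + 1))) := by
        gcongr
        omega
    _ = 4 * (2 ^ r + 1) * 2 * m * (r ^ (r * k) * (k ^ (r * k) * k ^ k) *
        (n ^ r * n * n ^ (d + 1))) := by rw [mul_pow]; ring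
    _ ≤ _ := by
        rw [← pow_add, ← Nat.succ_mul]
        gcongr

end Packing

theorem mainTheorem3 (d : ℕ) :
    ∃ c : ℕ, ∀ (r : ℕ) (α : OverlapFn) (P : SubgraphProp), 1 ≤ r →
      WellConditioned r d α → Verifiable r d P →
        PackingSolvableInTime r P α
          (fun n k => r ^ (r * k) * k ^ ((r + 1) * k) * n ^ (c * r)) := by
  classical
  refine ⟨d + 3, fun r α P hr hα hP => ?_⟩
  obtain ⟨U, cU, hU⟩ := exists_run_union
  obtain ⟨I, cI, hI⟩ := exists_run_subset
  obtain ⟨pa, Ca, hpa⟩ := hα.computable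
  obtain ⟨pv, Cv, hpv⟩ := hP
  obtain ⟨F, C, hF⟩ := exists_run_packing U I (Code.ofProg pa) (Code.ofProg pv) r hr
  -- All basic operations take at most `m * n ^ (d + 1)` steps. The exponent is `d + 1` because set
  -- operations need linear time even if `d = 0`; the factors `2` come from `n + 1 ≤ 2 * n`.
  set m := 2 * cU + 2 * cI + (pa.bound + 1 + Ca) + (pv.bound + 1 + Cv) with hm
  refine ⟨F 0, C * (4 * (2 ^ r + 1) * 2 * m), fun n G k hn => ?_⟩
  have hnd : n ^ d ≤ n ^ (d + 1) := Nat.pow_le_pow_right hn (by omega)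
  have hn1 : n ≤ n ^ (d + 1) := Nat.le_self_pow (by omega) n
  have h1 : 1 ≤ n ^ (d + 1) := Nat.pow_pos hn
  have hset : ∀ {c x : ℕ}, 2 * c ≤ x → c * (n + 1) ≤ x * n ^ (d + 1) := fun {c x} h =>
    calc c * (n + 1) ≤ c * (2 * n) := Nat.mul_le_mul_left _ (by omega)
      _ = 2 * c * n := by ring
      _ ≤ _ := Nat.mul_le_mul h hn1
  have hprog : ∀ {b c x : ℕ}, b + 1 + c ≤ x → b + 1 + c * n ^ d ≤ x * n ^ (d + 1) :=
    fun {b c x} h =>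
    calc b + 1 + c * n ^ d ≤ (b + 1 + c) * n ^ (d + 1) := by nlinarith
      _ ≤ _ := Nat.mul_le_mul_right _ h
  have hops : Ops U I (Code.ofProg pa) n r (encGraph G)
      (fun s t : Finset (Fin n) => α n G s t) (m * n ^ (d + 1)) :=
    { union := fun s t => (hU n s t).mono (hset (by omega))
      subset := fun s t => (hI n s t).mono (hset (by omega))
      overlap := fun s t hs ht => by
        have := (hpa n G s t hn (by simpa using hs) (by simpa using ht)).run
        rw [Bool.decide_eq_true] at this
        exact this.mono (hprog (by omega))
      pos := Nat.mul_pos (by omega) h1 }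
  obtain ⟨cands, hc, b, hb, hrun⟩ := hF n (m * n ^ (d + 1)) k
    (List.ofFn fun i : Fin n => encSet (G.neighborSet i)) (fun s t => α n G s t)
    (fun s => decide (P n G ((⊤ : G.Subgraph).induce (s : Set (Fin n))))) (by simp) hops
    (fun s hs => (hpv n G ((⊤ : G.Subgraph).induce (s : Set (Fin n))) hn
      ((SimpleGraph.Subgraph.isInduced_iff_exists_eq_induce_top _).2 ⟨_, rfl⟩)
      (by simpa using hs)).run.mono (hprog (by omega)))
    (fun cands singles hc hs => hα.setting G hc hs)
  refine (hrun.mono ?_).decidesWithin (hb.trans (packs_iff fun s => ?_))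
  · rw [Nat.mul_assoc C]
    exact Nat.mul_le_mul_left _ (time_le hr hn)
  · rw [hc, decide_eq_true_iff]
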